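/- Notation. For $m\in\mathbb N$ let $C_m=C((-\infty,0],\mathbb R^m)$ be the Fréchet space of continuous maps with the topology of locally uniform convergence. For a map $x$ with values in $\mathbb R^m$ defined (at least) on $(-\infty,t]$ let $x_t(s)=x(t+s)$, $s\le 0$. Let $\ast\in\{MB,F\}$. A continuous map $f:U\to F$ on an open subset $U$ of a topological vector space $E$, with values in a topological vector space $F$, is $C^1_{MB}$-smooth if all directional derivatives $Df(u)v=\lim_{0\ne h\to0}\frac1h(f(u+hv)-f(u))$, $u\in U$, $v\in E$, exist and $(u,v)\mapsto Df(u)v$ is continuous on $U\times E$; it is $C^1_F$-smooth if all directional derivatives exist, each $Df(u):E\to F$ is linear and continuous, and $u\mapsto Df(u)\in L_c(E,F)$ is continuous for the topology of uniform convergence on bounded sets. Let $V\subset\mathbb R\times C_n$ and $g:V\to\mathbb R^n$. For $(t_0,\phi)\in V$, a solution of the initial value problem $$x'(t)=g(t,x_t)\ \text{ for } t\ge t_0,\qquad x_{t_0}=\phi,\qquad(1)$$ is a continuous map $x:(-\infty,t_e)\to\mathbb R^n$, $t_0<t_e\le\infty$, with $x_{t_0}=\phi$, such that for all $t\in[t_0,t_e)$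 we have $(t,x_t)\in V$, and $x|_{[t_0,t_e)}$ is differentiable at $t$ with derivative $g(t,x_t)$. It is maximal if every solution of the same problem is a restriction of it; a maximal solution is unique. Solutions of autonomous problems $y'(s)=f(y_s)$, $y_0=\psi\in U$, for $f:C_m\supset U\to\mathbb R^m$ are defined in the same way. Let $p_n:C_{n+1}\to C_n$ forget the first component, and put $$U_g=\{\psi\in C_{n+1}:(\psi_1(0),p_n\psi)\in V\},\qquad f_g:U_g\to\mathbb R^{n+1},\quad f_g(\psi)=(1,g(\psi_1(0),p_n\psi)).$$ For $\psi\in U_g$ let $t_\psi=\sup\{t>0:\ y'(s)=f_g(y_s),\ y_0=\psi,\text{ has a solution on }[0,t]\}\le\infty$, let $y^\psi:(-\infty,t_\psi)\to\mathbb R^{n+1}$ be given by the values of these solutions, and put $$\Omega_g=\{(t,\psi)\in[0,\infty)\times U_g:t<t_\psi\},\qquad \Sigma_g(t,\psi)=y^\psi_t .$$ For $t\in\mathbb R$ define $t_*\in C_1$ by $t_*(u)=t+u$. Finally let $$dom=\{(t,t_0,\phi)\in\mathbb R^2\times C_n:\ t_0\le t,\ (t-t_0,t_{0*},\phi)\in\Omega_g\},\qquad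 P(t,t_0,\phi)=p_n\Sigma_g(t-t_0,t_{0*},\phi).$$ Theorem. Suppose that $V$ is open and $g$ is $C^1_\ast$-smooth. Then the following holds. (a) $U_g$ is open and $f_g$ is $C^1_\ast$-smooth. For each $\psi\in U_g$, $y^\psi$ is well defined and is the maximal solution of $y'(s)=f_g(y_s)$, $y_0=\psi$, on $[0,t_\psi)$. $\Omega_g$ is open in $[0,\infty)\times C_{n+1}$, and $\Sigma_g:\Omega_g\to U_g$ is a continuous semiflow: $(0,\psi)\in\Omega_g$ and $\Sigma_g(0,\psi)=\psi$ for all $\psi\in U_g$, and if $(t,\psi)\in\Omega_g$ and $(s,\Sigma_g(t,\psi))\in\Omega_g$ then $(s+t,\psi)\in\Omega_g$ and $\Sigma_g(s,\Sigma_g(t,\psi))=\Sigma_g(s+t,\psi)$. For every $t\ge0$ the set $\{\psi:(t,\psi)\in\Omega_g\}$ is open, and $\Sigma_g(t,\cdot)$ is $C^1_\ast$-smooth on it. (b) $dom$ is open in $\{(t,t_0)\in\mathbb R^2:t_0\le t\}\times C_n$, and $P:dom\to C_n$ is continuous. For all $t_0\le t$ the set $dom_{t,t_0}=\{\phi\in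 C_n:(t,t_0,\phi)\in dom\}$ is open, and $P(t,t_0,\cdot):dom_{t,t_0}\to C_n$ is $C^1_\ast$-smooth. (c) If $(t,t_0,\phi)\in dom$ then $(t_0,\phi)\in V$. For every $(t_0,\phi)\in V$ the problem (1) has a maximal solution $x=x^{t_0,\phi}$, on some interval $[t_0,t_e)$; for $t\in\mathbb R$ one has $(t,t_0,\phi)\in dom$ if and only if $t_0\le t<t_e$, and then $P(t,t_0,\phi)=x_t$. (d) For all $(t_0,\phi)\in V$, $(t_0,t_0,\phi)\in dom$ and $P(t_0,t_0,\phi)=\phi$. For all $t_0\le t\le s$ with $(t,t_0,\phi)\in dom$ and $(s,t,P(t,t_0,\phi))\in dom$ one has $(s,t_0,\phi)\in dom$ and $P(s,t_0,\phi)=P(s,t,P(t,t_0,\phi))$. -/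

import Mathlib

open Set Filter Topology

namespace DelayEquation

/-! Calculus in real topological vector spaces -/

section Calculus

variable {E F : Type*} [AddCommGroup E] [Module ℝ E] [TopologicalSpace E]
  [AddCommGroup F] [Module ℝ F] [TopologicalSpace F]

/-- `w` is the directional derivative of `f` at `u` in the direction `v`. -/
def HasDirDeriv (f : E → F) (u v : E) (w : F) : Prop :=
  Tendsto (fun h : ℝ => h⁻¹ • (f (u + h • v) - f u)) (𝓝[≠] 0) (𝓝 w)

/-- Continuous differentiability on `U` in the sense of Michal and Bastiani: `f` is continuous, all
directional derivatives exist, and `(u, v) ↦ Df(u)v` is continuous on `U × E`. -/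
def IsC1MB (f : E → F) (U : Set E) : Prop :=
  ContinuousOn f U ∧ ∃ Df : E → E → F,
    (∀ u ∈ U, ∀ v, HasDirDeriv f u v (Df u v)) ∧
    ContinuousOn (fun p : E × E => Df p.1 p.2) (U ×ˢ univ)

/-- Continuous differentiability on `U` in the sense of Fréchet: `f` is continuous, all directional
derivatives exist, each `Df(u)` is a continuous linear map, and `u ↦ Df(u)` is continuous on `U`
into `E →L[ℝ] F`, whose topology in Mathlib is that of uniform convergence on bounded sets. -/
def IsC1F [IsTopologicalAddGroup F] [ContinuousSMul ℝ F] (f : E → F) (U : Set E) : Prop :=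
  ContinuousOn f U ∧ ∃ Df : E → E →L[ℝ] F,
    (∀ u ∈ U, ∀ v, HasDirDeriv f u v (Df u v)) ∧ ContinuousOn Df U

/-- The two notions of smoothness: Michal-Bastiani, and Fréchet. -/
inductive Variant
  | MB
  | F

/-- `f` is `C¹_*`-smooth on `U`, with `* = MB` or `* = F`. -/
def IsC1 [IsTopologicalAddGroup F] [ContinuousSMul ℝ F] (star : Variant) (f : E → F)
    (U : Set E) : Prop :=
  match star with
  | .MB => IsC1MB f U
  | .F => IsC1F f U

end Calculus

/-! The state space and solutions of delay differential equations -/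

/-- The space `C_m = C((-∞, 0], ℝ^m)`; its topology (the compact-open one) is that of locally
uniform convergence. Only the topology of `ℝ^m` matters, not the choice of a norm. -/
abbrev History (m : ℕ) : Type := C(Iic (0 : ℝ), Fin m → ℝ)

/-- `ψ` is the segment `x_t`, that is, `ψ(s) = x(t + s)` for `s ≤ 0`. -/
def IsSegment {m : ℕ} (x : ℝ → Fin m → ℝ) (t : ℝ) (ψ : History m) : Prop :=
  ∀ s : Iic (0 : ℝ), ψ s = x (t + s)

/-- `x` is a solution of `x'(t) = g(t, x_t)`, `g : V → ℝ^m`, on the interval `I`. Only the values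
of `x` on `(-∞, 0] + I` matter. Derivatives are those of the restriction of `x` to `I`.
Since `x_t` is a continuous map for each `t ∈ I`, solutions are continuous on `(-∞, 0] + I`. -/
def IsSolutionOn {m : ℕ} (V : Set (ℝ × History m)) (g : ℝ × History m → Fin m → ℝ)
    (I : Set ℝ) (x : ℝ → Fin m → ℝ) : Prop :=
  ∀ t ∈ I, ∃ ψ : History m, IsSegment x t ψ ∧ (t, ψ) ∈ V ∧ HasDerivWithinAt x (g (t, ψ)) I t

/-- `x` is a solution on `[t₀, te)`, `t₀ < te ≤ ∞`, of the initial value problem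
`x'(t) = g(t, x_t)` for `t ≥ t₀`, `x_{t₀} = φ`. -/
def IsIVPSolution {m : ℕ} (V : Set (ℝ × History m)) (g : ℝ × History m → Fin m → ℝ)
    (t₀ : ℝ) (φ : History m) (te : EReal) (x : ℝ → Fin m → ℝ) : Prop :=
  (t₀ : EReal) < te ∧ IsSolutionOn V g {t : ℝ | t₀ ≤ t ∧ (t : EReal) < te} x ∧ IsSegment x t₀ φ

/-- `x` on `(-∞, te)` is the maximal solution of the initial value problem: it is a solution, and
every solution of the same initial value problem is a restriction of it. -/
def IsMaximalSolution {m : ℕ} (V : Set (ℝ × History m)) (g : ℝ × History m → Fin m → ℝ)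
    (t₀ : ℝ) (φ : History m) (te : EReal) (x : ℝ → Fin m → ℝ) : Prop :=
  IsIVPSolution V g t₀ φ te x ∧
    ∀ (te' : EReal) (x' : ℝ → Fin m → ℝ), IsIVPSolution V g t₀ φ te' x' →
      te' ≤ te ∧ ∀ s : ℝ, (s : EReal) < te' → x' s = x s

/-! The autonomous equation `y'(t) = f(y_t)`, `f : U → ℝ^m`, and its semiflow -/

/-- The autonomous equation as an equation `x'(t) = g(t, x_t)`: the domain `ℝ × U` ... -/
def autDom {m : ℕ} (U : Set (History m)) : Set (ℝ × History m) := {p | p.2 ∈ U}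

/-- ... and the right hand side `(t, φ) ↦ f(φ)`. -/
def autRhs {m : ℕ} (f : History m → Fin m → ℝ) : ℝ × History m → Fin m → ℝ := fun p => f p.2

/-- `y` is a solution of `y'(t) = f(y_t)` on `[0, T]` with `y_0 = φ`. -/
def IsAutSolution {m : ℕ} (U : Set (History m)) (f : History m → Fin m → ℝ) (φ : History m)
    (T : ℝ) (y : ℝ → Fin m → ℝ) : Prop :=
  IsSolutionOn (autDom U) (autRhs f) (Icc 0 T) y ∧ IsSegment y 0 φ

/-- The escape time `t_φ ≤ ∞`. -/
noncomputable def escapeTime {m : ℕ} (U : Set (History m)) (f : History m → Fin m → ℝ)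
    (φ : History m) : EReal :=
  sSup {T : EReal | ∃ t : ℝ, 0 < t ∧ T = t ∧ ∃ y, IsAutSolution U f φ t y}

open Classical in
/-- The maximal solution `y^φ`: at time `t`, it is the value of any solution on some `[0, T]`,
`T > t`, with initial value `φ`. -/
noncomputable def maxSolution {m : ℕ} (U : Set (History m)) (f : History m → Fin m → ℝ)
    (φ : History m) (t : ℝ) : Fin m → ℝ :=
  if h : ∃ y : ℝ → Fin m → ℝ, ∃ T : ℝ, 0 < T ∧ t < T ∧ IsAutSolution U f φ T y
  then h.choose t else 0

/-- The domain `Ω = {(t, φ) ∈ [0, ∞) × U : t < t_φ}` of the semiflow. -/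
def flowDom {m : ℕ} (U : Set (History m)) (f : History m → Fin m → ℝ) : Set (ℝ × History m) :=
  {p | 0 ≤ p.1 ∧ p.2 ∈ U ∧ (p.1 : EReal) < escapeTime U f p.2}

open Classical in
/-- The semiflow `Σ(t, φ) = y^φ_t` (with the value `0` where this segment is not defined). -/
noncomputable def flow {m : ℕ} (U : Set (History m)) (f : History m → Fin m → ℝ)
    (t : ℝ) (φ : History m) : History m :=
  if h : ∃ ψ : History m, IsSegment (maxSolution U f φ) t ψ then h.choose else 0

/-! From the nonautonomous to the autonomous equation -/

/-- The map `p_n : C_{n+1} → C_n` forgetting the first component. -/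
def forget {n : ℕ} (ψ : History (n + 1)) : History n where
  toFun s := Fin.tail (ψ s)
  continuous_toFun := by
    unfold Fin.tail
    fun_prop

/-- The element `t_* ∈ C_1`, `t_*(u) = t + u`. -/
def clock (t : ℝ) : C(Iic (0 : ℝ), ℝ) where
  toFun u := t + u
  continuous_toFun := by fun_prop

/-- The element `(ρ, φ) ∈ C_{n+1}` for `ρ ∈ C_1` and `φ ∈ C_n`. -/
def pair {n : ℕ} (ρ : C(Iic (0 : ℝ), ℝ)) (φ : History n) : History (n + 1) where
  toFun u := Fin.cons (ρ u) (φ u)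
  continuous_toFun := by
    refine continuous_pi fun i => ?_
    refine Fin.cases ?_ (fun j => ?_) i
    · simp only [Fin.cons_zero]; fun_prop
    · simp only [Fin.cons_succ]; fun_prop

/-- The map `ψ ↦ (ψ₁(0), p_n ψ)`. -/
def split {n : ℕ} (ψ : History (n + 1)) : ℝ × History n := (ψ ⟨0, self_mem_Iic⟩ 0, forget ψ)

/-- The domain `U_g = {ψ ∈ C_{n+1} : (ψ₁(0), p_n ψ) ∈ V}`. -/
def augDom {n : ℕ} (V : Set (ℝ × History n)) : Set (History (n + 1)) := {ψ | split ψ ∈ V}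

/-- The map `f_g(ψ) = (1, g(ψ₁(0), p_n ψ))`. -/
def augRhs {n : ℕ} (g : ℝ × History n → Fin n → ℝ) : History (n + 1) → Fin (n + 1) → ℝ :=
  fun ψ => Fin.cons 1 (g (split ψ))

/-- The domain `Ω_g` of the semiflow of `y'(t) = f_g(y_t)`. -/
def augFlowDom {n : ℕ} (V : Set (ℝ × History n)) (g : ℝ × History n → Fin n → ℝ) :
    Set (ℝ × History (n + 1)) :=
  flowDom (augDom V) (augRhs g)

/-- The semiflow `Σ_g` of `y'(t) = f_g(y_t)`. -/
noncomputable def augFlow {n : ℕ} (V : Set (ℝ × History n)) (g : ℝ × History n → Fin n → ℝ)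
    (t : ℝ) (ψ : History (n + 1)) : History (n + 1) :=
  flow (augDom V) (augRhs g) t ψ

/-- The domain `dom = {(t, t₀, φ) : t₀ ≤ t, (t - t₀, t₀_*, φ) ∈ Ω_g}` of the process. -/
def processDom {n : ℕ} (V : Set (ℝ × History n)) (g : ℝ × History n → Fin n → ℝ) :
    Set (ℝ × ℝ × History n) :=
  {p | p.2.1 ≤ p.1 ∧ (p.1 - p.2.1, pair (clock p.2.1) p.2.2) ∈ augFlowDom V g}

/-- The process `P(t, t₀, φ) = p_n Σ_g(t - t₀, t₀_*, φ)`. -/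
noncomputable def process {n : ℕ} (V : Set (ℝ × History n)) (g : ℝ × History n → Fin n → ℝ)
    (t t₀ : ℝ) (φ : History n) : History n :=
  forget (augFlow V g (t - t₀) (pair (clock t₀) φ))

end DelayEquation

open DelayEquation

/-! A clock component with derivative 1 turns the nonautonomous problem into an autonomous one,
$y'=f(y_s)$ on an open set $U\subset C_m$. The analysis is done there. The process is then the
semiflow restricted to initial states whose first component is a clock, with continuous affine maps
on both sides.

The space $C_m$ is only a Fréchet space, with topology given by the seminorms `nrm k`. What makes
the equation tractable is that a $C^1_{MB}$ map into $\mathbb R^m$ is, near each point, Lipschitz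
with respect to a single seminorm. By compactness, one seminorm, one radius and one Lipschitz
constant serve along a whole compact solution curve (`exists_isTube`). Fréchet smoothness implies
Michal-Bastiani smoothness here because $C_m$ is first countable.

Truncating the deviation from a solution curve makes the right hand side globally Lipschitz, so the
truncated equation is solved by a contraction (`exists_solution_of_lipschitz`). A Gronwall estimate
for delay equations (`norm_le_of_delay_gronwall`) shows that the truncation is inactive for nearby
initial data, up to a time strictly beyond the given one. The result, `exists_isFlowBox`, yields
local existence, openness of the domain and continuous dependence. Uniqueness is proved separately
from the same Gronwall estimate and identifies the solutions chosen in the definition of the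
semiflow.

The derivative of $\Sigma(t,\cdot)$ at $\psi$ in direction $v$ is $w_t$, where $w'(s)=Df(z_s)w_s$,
$w_0=v$, along the solution $z$ starting at $\psi$. The map $Df(z_s)$ inherits the Lipschitz
constant of $f$, so the existence theorem and the Gronwall estimate apply again
(`IsFlowBox.hasDirDeriv_flow`). Continuity of the derivative is a comparison of two variational
equations, where the change of coefficient acts as a small inhomogeneity: along one solution in the
MB case, along all solutions starting in a bounded set in the F case. -/

namespace DelayEquation

/-! ### Seminorms generating the topology of locally uniform convergence. -/

section Seminorms

variable {m : ℕ}

/-- The inclusion of `[-k, 0]` into `(-∞, 0]`. -/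
def window (k : ℕ) : C(Icc (-(k : ℝ)) 0, Iic (0 : ℝ)) where
  toFun s := ⟨s, s.2.2⟩
  continuous_toFun := by fun_prop

/-- The seminorm `max {‖ψ s‖ : -k ≤ s ≤ 0}`. -/
noncomputable def nrm (k : ℕ) (ψ : History m) : ℝ := ‖ψ.comp (window k)‖

theorem nrm_nonneg (k : ℕ) (ψ : History m) : 0 ≤ nrm k ψ := norm_nonneg _

theorem norm_apply_le_nrm {k : ℕ} (ψ : History m) {s : Iic (0 : ℝ)} (hs : -(k : ℝ) ≤ s) :
    ‖ψ s‖ ≤ nrm k ψ :=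
  (ψ.comp (window k)).norm_coe_le_norm ⟨s, hs, s.2⟩

theorem nrm_le {k : ℕ} {ψ : History m} {c : ℝ} (hc : 0 ≤ c)
    (h : ∀ s : Iic (0 : ℝ), -(k : ℝ) ≤ s → ‖ψ s‖ ≤ c) : nrm k ψ ≤ c :=
  (ContinuousMap.norm_le _ hc).2 fun s => h _ s.2.1

theorem nrm_mono {k l : ℕ} (h : k ≤ l) (ψ : History m) : nrm k ψ ≤ nrm l ψ :=
  nrm_le (nrm_nonneg _ _) fun s hs => norm_apply_le_nrm ψ <| by
    have : (k : ℝ) ≤ l := by exact_mod_cast h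
    linarith

theorem nrm_add_le (k : ℕ) (ψ χ : History m) : nrm k (ψ + χ) ≤ nrm k ψ + nrm k χ :=
  norm_add_le (ψ.comp (window k)) (χ.comp (window k))

theorem nrm_smul (k : ℕ) (c : ℝ) (ψ : History m) : nrm k (c • ψ) = |c| * nrm k ψ :=
  norm_smul c (ψ.comp (window k))

@[simp] theorem nrm_zero (k : ℕ) : nrm k (0 : History m) = 0 :=
  norm_zero (E := C(Icc (-(k : ℝ)) 0, Fin m → ℝ))

theorem nrm_sub_comm (k : ℕ) (ψ χ : History m) : nrm k (ψ - χ) = nrm k (χ - ψ) :=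
  norm_sub_rev (ψ.comp (window k)) (χ.comp (window k))

theorem nrm_sub_le (k : ℕ) (ψ χ ξ : History m) :
    nrm k (ψ - ξ) ≤ nrm k (ψ - χ) + nrm k (χ - ξ) :=
  norm_sub_le_norm_sub_add_norm_sub (ψ.comp (window k)) (χ.comp (window k)) (ξ.comp (window k))

@[fun_prop]
theorem continuous_nrm (k : ℕ) : Continuous (nrm k : History m → ℝ) :=
  continuous_norm.comp (ContinuousMap.continuous_precomp _)

/-- Every compact subset of $(-\infty,0]$ is contained in some $[-k,0]$, and a single seminorm
suffices in each basic neighbourhood because the seminorms increase with $k$. -/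
theorem nhds_basis_nrm (ψ₀ : History m) :
    (𝓝 ψ₀).HasBasis (fun p : ℕ × ℝ => 0 < p.2) fun p => {ψ | nrm p.1 (ψ - ψ₀) < p.2} := by
  have hb := nhds_basis_uniformity' (x := ψ₀) ((Metric.uniformity_basis_dist
    (α := Fin m → ℝ)).compactConvergenceUniformity (α := Iic (0 : ℝ)))
  refine ⟨fun t => ⟨fun ht => ?_, ?_⟩⟩
  · obtain ⟨⟨K, r⟩, ⟨hK, hr⟩, hKt⟩ := hb.mem_iff.1 ht
    obtain ⟨B, hB⟩ := (hK.image continuous_subtype_val).bddBelow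
    obtain ⟨k, hk⟩ := exists_nat_gt (-B)
    refine ⟨(k, r), hr, fun ψ hψ => hKt fun s hs => ?_⟩
    have hBs : B ≤ s := hB (mem_image_of_mem _ hs)
    have := norm_apply_le_nrm (k := k) (ψ - ψ₀) (s := s) (by linarith)
    change dist (ψ₀ s) (ψ s) < r
    rw [dist_comm, dist_eq_norm]
    exact this.trans_lt hψ
  · rintro ⟨⟨k, r⟩, hr, h⟩
    have hc : Continuous fun ψ : History m => nrm k (ψ - ψ₀) := by fun_prop
    refine mem_of_superset ((isOpen_lt hc continuous_const).mem_nhds ?_) h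
    simpa using hr

theorem tendsto_iff_nrm {ι : Type*} {l : Filter ι} {f : ι → History m} {ψ₀ : History m} :
    Tendsto f l (𝓝 ψ₀) ↔ ∀ k : ℕ, ∀ r > 0, ∀ᶠ i in l, nrm k (f i - ψ₀) < r :=
  (nhds_basis_nrm ψ₀).tendsto_right_iff.trans
    ⟨fun h k r hr => h (k, r) hr, fun h p hp => h p.1 p.2 hp⟩

theorem eventually_nrm_sub_lt (k : ℕ) (ψ₀ : History m) {r : ℝ} (hr : 0 < r) :
    ∀ᶠ ψ in 𝓝 ψ₀, nrm k (ψ - ψ₀) < r :=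
  tendsto_iff_nrm.1 tendsto_id k r hr

end Seminorms

/-! ### Segments of continuous curves on the real line. -/

section Segments

variable {m : ℕ}

/-- The segment `z_t` of a continuous map on the real line. -/
def seg (z : C(ℝ, Fin m → ℝ)) (t : ℝ) : History m where
  toFun s := z (t + s)
  continuous_toFun := by fun_prop

@[simp] theorem seg_apply (z : C(ℝ, Fin m → ℝ)) (t : ℝ) (s : Iic (0 : ℝ)) :
    seg z t s = z (t + s) := rfl

@[fun_prop]
theorem continuous_seg (z : C(ℝ, Fin m → ℝ)) : Continuous (seg z) :=
  (ContinuousMap.curry ⟨fun p : ℝ × Iic (0 : ℝ) => z (p.1 + p.2), by fun_prop⟩).continuous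

theorem seg_sub (z w : C(ℝ, Fin m → ℝ)) (t : ℝ) : seg (z - w) t = seg z t - seg w t := rfl

theorem seg_add (z w : C(ℝ, Fin m → ℝ)) (t : ℝ) : seg (z + w) t = seg z t + seg w t := rfl

theorem seg_smul (c : ℝ) (z : C(ℝ, Fin m → ℝ)) (t : ℝ) : seg (c • z) t = c • seg z t := rfl

theorem seg_congr {z w : C(ℝ, Fin m → ℝ)} {t : ℝ} (h : ∀ s ≤ t, z s = w s) :
    seg z t = seg w t := by
  ext1 s
  exact h _ (by have := s.2; simp only [mem_Iic] at this; linarith)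

theorem apply_eq_of_seg_eq {z w : C(ℝ, Fin m → ℝ)} {t s : ℝ} (h : seg z t = seg w t)
    (hs : s ≤ t) : z s = w s := by
  simpa using DFunLike.congr_fun h ⟨s - t, by simpa using hs⟩

theorem nrm_seg_le {k : ℕ} {z : C(ℝ, Fin m → ℝ)} {t c : ℝ} (hc : 0 ≤ c)
    (h : ∀ s ≤ t, t - k ≤ s → ‖z s‖ ≤ c) : nrm k (seg z t) ≤ c :=
  nrm_le hc fun s hs => h _ (by have := s.2; simp only [mem_Iic] at this; linarith) (by linarith)

theorem norm_apply_le_nrm_seg {k : ℕ} (z : C(ℝ, Fin m → ℝ)) {t s : ℝ} (hs : s ≤ t)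
    (hk : t - k ≤ s) : ‖z s‖ ≤ nrm k (seg z t) := by
  simpa using norm_apply_le_nrm (k := k) (seg z t) (s := ⟨s - t, by simpa using hs⟩)
    (by simp only; linarith)

end Segments

/-! ### A Gronwall estimate for delay differential inequalities. -/

section Gronwall

variable {m : ℕ}

/-- The constant in the Gronwall type estimate. -/
noncomputable def gronwallConst (L S : ℝ) : ℝ :=
  2 * (1 + (L + 1) * S) * Real.exp ((2 * L + 1) * S)

theorem one_le_gronwallConst {L S : ℝ} (hL : 0 ≤ L) (hS : 0 ≤ S) : 1 ≤ gronwallConst L S := by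
  have h1 : 1 ≤ Real.exp ((2 * L + 1) * S) := Real.one_le_exp (by positivity)
  have h2 : 0 ≤ (L + 1) * S := by positivity
  unfold gronwallConst
  nlinarith

/-- Let $M$ be the maximum of $e^{-lt}\|d(t)\|$ on $[0,S]$, attained at $\tau$. Segments of $d$ are
bounded by $a+Me^{lt}$, so integrating the bound for $d'$ up to $\tau$ gives $Me^{l\tau}\le
a+(La+\eta)\tau+\frac{LM}{l}e^{l\tau}$. With $l=2L+1$ the last term is at most half of the left side
and is absorbed. -/
theorem norm_le_of_delay_gronwall {d : C(ℝ, Fin m → ℝ)} {d' : ℝ → Fin m → ℝ} {j : ℕ}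
    {S L a η : ℝ} (hL : 0 ≤ L) (ha : 0 ≤ a) (hη : 0 ≤ η)
    (hd : ∀ t ∈ Icc 0 S, HasDerivWithinAt d (d' t) (Icc 0 S) t)
    (bound : ∀ t ∈ Icc 0 S, ‖d' t‖ ≤ L * nrm j (seg d t) + η)
    (h0 : ∀ s ≤ 0, -(j : ℝ) ≤ s → ‖d s‖ ≤ a) {t : ℝ} (ht : t ∈ Icc 0 S) :
    ‖d t‖ ≤ gronwallConst L S * (a + η) := by
  have hS : 0 ≤ S := ht.1.trans ht.2
  set l := 2 * L + 1 with hl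
  have hl0 : 0 < l := by positivity
  have hc : ContinuousOn (fun t => Real.exp (-(l * t)) * ‖d t‖) (Icc 0 S) := by fun_prop
  obtain ⟨τ, hτ, hmax⟩ := isCompact_Icc.exists_isMaxOn ⟨t, ht⟩ hc
  set M := Real.exp (-(l * τ)) * ‖d τ‖ with hM
  have hM0 : 0 ≤ M := by positivity
  have key : ∀ x ∈ Icc 0 S, ‖d x‖ ≤ M * Real.exp (l * x) := fun x hx => by
    have h : Real.exp (-(l * x)) * ‖d x‖ ≤ M := hmax hx
    calc ‖d x‖ = (Real.exp (-(l * x)) * ‖d x‖) * Real.exp (l * x) := by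
          rw [mul_right_comm, ← Real.exp_add]; simp
      _ ≤ _ := by gcongr
  have hseg : ∀ x ∈ Icc 0 S, nrm j (seg d x) ≤ a + M * Real.exp (l * x) := fun x hx => by
    refine nrm_seg_le (by positivity) fun s hs hk => ?_
    rcases le_total s 0 with h | h
    · refine (h0 s h (by linarith [hx.1])).trans (le_add_of_nonneg_right (by positivity))
    · refine (key s ⟨h, hs.trans hx.2⟩).trans ?_
      have : M * Real.exp (l * s) ≤ M * Real.exp (l * x) := by gcongr
      linarith
  have hB : ∀ x, HasDerivAt (fun x => a + (L * a + η) * x + L * M / l * Real.exp (l * x))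
      (L * a + η + L * M * Real.exp (l * x)) x := fun x => by
    have h1 : HasDerivAt (fun x => Real.exp (l * x)) (Real.exp (l * x) * l) x := by
      simpa using ((hasDerivAt_id x).const_mul l).exp
    have h2 := (((hasDerivAt_id x).const_mul (L * a + η)).const_add a).add
      (h1.const_mul (L * M / l))
    refine h2.congr_deriv ?_
    field_simp
  have hτb := image_norm_le_of_norm_deriv_right_le_deriv_boundary (f := d) (f' := d') (a := 0)
    (b := S) (by fun_prop) (fun x hx => (hd x (Ico_subset_Icc_self hx)).mono_of_mem_nhdsWithin
      (Icc_mem_nhdsGE_of_mem hx))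
    (by
      have := h0 0 le_rfl (by simp)
      have h' : 0 ≤ L * M / l := by positivity
      simp only [mul_zero, add_zero, Real.exp_zero, mul_one]
      linarith) hB
    (fun x hx => by
      refine (bound x (Ico_subset_Icc_self hx)).trans ?_
      have := mul_le_mul_of_nonneg_left (hseg x (Ico_subset_Icc_self hx)) hL
      linarith) hτ
  have hdτ : ‖d τ‖ = M * Real.exp (l * τ) := by
    rw [hM, mul_right_comm, ← Real.exp_add]; simp
  have hE : 1 ≤ Real.exp (l * τ) := Real.one_le_exp (mul_nonneg hl0.le hτ.1)
  have hLl : L * M / l ≤ M / 2 := by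
    rw [div_le_div_iff₀ hl0 two_pos]
    nlinarith
  have hMb : M ≤ 2 * (a + (L * a + η) * S) := by
    simp only [hdτ] at hτb
    have h1 : L * M / l * Real.exp (l * τ) ≤ M / 2 * Real.exp (l * τ) := by gcongr
    have h2 : (L * a + η) * τ ≤ (L * a + η) * S := by gcongr; exact hτ.2
    have h3 : M / 2 ≤ M / 2 * Real.exp (l * τ) := le_mul_of_one_le_right (by positivity) hE
    linarith
  calc ‖d t‖ ≤ M * Real.exp (l * t) := key t ht
    _ ≤ (2 * (a + (L * a + η) * S)) * Real.exp (l * S) := by gcongr; exact ht.2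
    _ ≤ (2 * (1 + (L + 1) * S) * (a + η)) * Real.exp (l * S) := by
        refine mul_le_mul_of_nonneg_right ?_ (Real.exp_pos _).le
        have : 0 ≤ L * η * S := by positivity
        have : 0 ≤ a * S := by positivity
        linarith
    _ = _ := by rw [gronwallConst]; ring

end Gronwall

/-! ### Existence for globally Lipschitz right hand sides, by contraction. -/

section Existence

variable {m : ℕ}

/-- The map which equals `ψ` on `(-∞, 0]`, and is `ψ(0) + ∫₀ᵗ e^{ls} q(s) ds` for `t ≥ 0`. -/
noncomputable def picardExt (ψ : History m) (l : ℝ) {S : ℝ} (hS : 0 ≤ S)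
    (q : C(Icc 0 S, Fin m → ℝ)) : C(ℝ, Fin m → ℝ) where
  toFun t := ψ ⟨min t 0, mem_Iic.2 (min_le_right _ _)⟩ +
    ∫ s in (0 : ℝ)..max t 0, Real.exp (l * s) • q (projIcc 0 S hS s)
  continuous_toFun := by
    have h : Continuous fun t => ∫ s in (0 : ℝ)..t, Real.exp (l * s) • q (projIcc 0 S hS s) :=
      intervalIntegral.continuous_primitive (fun a b => Continuous.intervalIntegrable
        (by have := continuous_projIcc (h := hS); fun_prop) a b) 0
    have h' := h.comp (continuous_id.max continuous_const : Continuous fun t : ℝ => max t 0)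
    have h2 : Continuous fun t : ℝ => ψ ⟨min t 0, mem_Iic.2 (min_le_right _ _)⟩ := by fun_prop
    exact h2.add h'

theorem seg_picardExt_zero (ψ : History m) (l : ℝ) {S : ℝ} (hS : 0 ≤ S)
    (q : C(Icc 0 S, Fin m → ℝ)) : seg (picardExt ψ l hS q) 0 = ψ := by
  ext1 s
  have hs : (s : ℝ) ≤ 0 := s.2
  simp [picardExt, hs]

/-- Integrating the weight $e^{ls}$ gains the factor $1/l$, which beats the Lipschitz constant on an
interval of any length. The pasts cancel, so the bound holds for all $s\le t$ and hence for whole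
segments. -/
theorem norm_picardExt_sub_le (ψ : History m) {l : ℝ} (hl : 0 < l) {S : ℝ} (hS : 0 ≤ S)
    (q q' : C(Icc 0 S, Fin m → ℝ)) {t s : ℝ} (ht : 0 ≤ t) (hst : s ≤ t) :
    ‖(picardExt ψ l hS q - picardExt ψ l hS q') s‖ ≤ Real.exp (l * t) / l * ‖q - q'‖ := by
  have hp := continuous_projIcc (h := hS)
  have hi : ∀ p : C(Icc 0 S, Fin m → ℝ), IntervalIntegrable
      (fun s => Real.exp (l * s) • p (projIcc 0 S hS s)) MeasureTheory.volume 0 (max s 0) :=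
    fun p => Continuous.intervalIntegrable (by fun_prop) _ _
  have e : (picardExt ψ l hS q - picardExt ψ l hS q') s =
      ∫ r in (0 : ℝ)..max s 0, Real.exp (l * r) • (q - q') (projIcc 0 S hS r) := by
    simp only [picardExt, ContinuousMap.sub_apply, ContinuousMap.coe_mk, add_sub_add_left_eq_sub,
      smul_sub]
    exact (intervalIntegral.integral_sub (hi q) (hi q')).symm
  rw [e]
  have hexp : ∀ r, HasDerivAt (fun r => Real.exp (l * r) / l) (Real.exp (l * r)) r := fun r => by
    have := (((hasDerivAt_id r).const_mul l).exp).div_const l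
    refine this.congr_deriv ?_
    simp [hl.ne']
  calc _ ≤ ∫ r in (0 : ℝ)..max s 0, Real.exp (l * r) * ‖q - q'‖ := by
        refine intervalIntegral.norm_integral_le_of_norm_le (le_max_right _ _)
          (Eventually.of_forall fun r _ => ?_)
          (Continuous.intervalIntegrable (by fun_prop) _ _)
        rw [norm_smul, Real.norm_eq_abs, Real.abs_exp]
        gcongr
        exact (q - q').norm_coe_le_norm _
    _ = (Real.exp (l * max s 0) / l - Real.exp (l * 0) / l) * ‖q - q'‖ := by
        rw [intervalIntegral.integral_mul_const,
          intervalIntegral.integral_eq_sub_of_hasDerivAt (fun r _ => hexp r)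
            (Continuous.intervalIntegrable (by fun_prop) _ _)]
    _ ≤ _ := by
        gcongr
        have : Real.exp (l * max s 0) / l ≤ Real.exp (l * t) / l := by
          gcongr; exact max_le hst ht
        have : 0 ≤ Real.exp (l * 0) / l := by positivity
        linarith

theorem hasDerivWithinAt_picardExt (ψ : History m) (l : ℝ) {S : ℝ} (hS : 0 ≤ S)
    (q : C(Icc 0 S, Fin m → ℝ)) {t : ℝ} (ht : t ∈ Icc 0 S) :
    HasDerivWithinAt (picardExt ψ l hS q) (Real.exp (l * t) • q ⟨t, ht⟩) (Icc 0 S) t := by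
  have hp := continuous_projIcc (h := hS)
  have hc : Continuous fun s => Real.exp (l * s) • q (projIcc 0 S hS s) := by fun_prop
  have h := (hc.integral_hasStrictDerivAt 0 t).hasDerivAt.const_add (ψ ⟨0, self_mem_Iic⟩)
  rw [projIcc_of_mem hS ht] at h
  refine h.hasDerivWithinAt.congr (fun s hs => ?_) ?_
  · simp [picardExt, hs.1]
  · simp [picardExt, ht.1]

/-- Existence for delay equations with a globally Lipschitz right hand side. -/
theorem exists_solution_of_lipschitz {S : ℝ} (hS : 0 ≤ S) {j : ℕ} {L : ℝ} (hL : 0 ≤ L)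
    (F : ℝ → History m → Fin m → ℝ)
    (hF : ∀ z : C(ℝ, Fin m → ℝ), ContinuousOn (fun t => F t (seg z t)) (Icc 0 S))
    (hLip : ∀ t ∈ Icc 0 S, ∀ χ χ', ‖F t χ - F t χ'‖ ≤ L * nrm j (χ - χ')) (ψ : History m) :
    ∃ z : C(ℝ, Fin m → ℝ), seg z 0 = ψ ∧
      ∀ t ∈ Icc 0 S, HasDerivWithinAt z (F t (seg z t)) (Icc 0 S) t := by
  set l := 2 * L + 1 with hl
  have hl0 : 0 < l := by positivity
  -- The unknown is the weighted derivative $q(t)=e^{-lt}z'(t)$, so a fixed point is a solution and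
  -- no differentiability has to be recovered. The choice of $l$ makes the contraction constant
  -- $L/l\le 1/2$.
  let Φ : C(Icc 0 S, Fin m → ℝ) → C(Icc 0 S, Fin m → ℝ) := fun q =>
    ⟨fun t => Real.exp (-(l * t)) • F t (seg (picardExt ψ l hS q) t), by
      have := (hF (picardExt ψ l hS q)).domRestrict
      have h2 : Continuous fun t : Icc (0 : ℝ) S => Real.exp (-(l * (t : ℝ))) := by fun_prop
      exact h2.smul this⟩
  have hΦ : ContractingWith (1 / 2) Φ := by
    refine ⟨by norm_num [← NNReal.coe_lt_coe], LipschitzWith.of_dist_le_mul fun q q' => ?_⟩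
    rw [dist_eq_norm, dist_eq_norm, ContinuousMap.norm_le _ (by positivity)]
    intro t
    have h1 := hLip t t.2 (seg (picardExt ψ l hS q) t) (seg (picardExt ψ l hS q') t)
    have h2 : nrm j (seg (picardExt ψ l hS q) t - seg (picardExt ψ l hS q') t) ≤
        Real.exp (l * t) / l * ‖q - q'‖ := by
      rw [← seg_sub]
      exact nrm_seg_le (by positivity) fun s hs _ =>
        norm_picardExt_sub_le ψ hl0 hS q q' t.2.1 hs
    calc ‖(Φ q - Φ q') t‖ = Real.exp (-(l * t)) *
          ‖F t (seg (picardExt ψ l hS q) t) - F t (seg (picardExt ψ l hS q') t)‖ := by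
          simp only [Φ, ContinuousMap.sub_apply, ContinuousMap.coe_mk, ← smul_sub, norm_smul,
            Real.norm_eq_abs, Real.abs_exp]
      _ ≤ Real.exp (-(l * t)) * (L * (Real.exp (l * t) / l * ‖q - q'‖)) := by
          gcongr
          exact h1.trans (by gcongr)
      _ = (Real.exp (-(l * t)) * Real.exp (l * t)) * (L / l) * ‖q - q'‖ := by ring
      _ = L / l * ‖q - q'‖ := by rw [← Real.exp_add]; simp
      _ ≤ _ := by
          gcongr
          rw [NNReal.coe_div, NNReal.coe_one, NNReal.coe_ofNat, div_le_div_iff₀ hl0 two_pos]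
          linarith
  obtain ⟨q, hq⟩ : ∃ q, Φ q = q := ⟨_, hΦ.fixedPoint_isFixedPt⟩
  refine ⟨picardExt ψ l hS q, seg_picardExt_zero ψ l hS q, fun t ht => ?_⟩
  refine (hasDerivWithinAt_picardExt ψ l hS q ht).congr_deriv ?_
  conv_lhs => rw [← hq]
  simp only [Φ, ContinuousMap.coe_mk, smul_smul, ← Real.exp_add]
  simp

end Existence

end DelayEquation

namespace DelayEquation

/-! ### Directional derivatives, and the comparison of the two notions of smoothness. -/

section DirectionalDerivatives

variable {E F : Type*} [AddCommGroup E] [Module ℝ E]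
  [AddCommGroup F] [Module ℝ F] [TopologicalSpace F]

theorem HasDirDeriv.unique [T2Space F] {f : E → F} {u v : E} {w w' : F}
    (h : HasDirDeriv f u v w) (h' : HasDirDeriv f u v w') : w = w' :=
  tendsto_nhds_unique h h'

/-- Linearity in the direction is not part of `IsC1MB`. Homogeneity is free, by rescaling the
parameter, and is all that the local Lipschitz estimate needs. -/
theorem HasDirDeriv.smul [ContinuousConstSMul ℝ F] {f : E → F} {u v : E} {w : F}
    (h : HasDirDeriv f u v w) (c : ℝ) : HasDirDeriv f u (c • v) (c • w) := by
  unfold HasDirDeriv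
  rcases eq_or_ne c 0 with rfl | hc
  · simpa using tendsto_const_nhds
  have hl : Tendsto (fun h : ℝ => h * c) (𝓝[≠] 0) (𝓝[≠] 0) := by
    refine tendsto_nhdsWithin_iff.2 ⟨?_, ?_⟩
    · have : Continuous fun h : ℝ => h * c := by fun_prop
      simpa using (this.tendsto 0).mono_left nhdsWithin_le_nhds
    · filter_upwards [self_mem_nhdsWithin] with x hx
      exact mul_ne_zero hx hc
  refine ((h.comp hl).const_smul c).congr fun x => ?_
  simp only [Function.comp_apply, smul_smul]
  rw [mul_inv, mul_left_comm, mul_inv_cancel₀ hc, mul_one]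

theorem HasDirDeriv.hasDerivAt {G : Type*} [NormedAddCommGroup G] [NormedSpace ℝ G] {f : E → G}
    {u v : E} {w : G} {θ : ℝ} (h : HasDirDeriv f (u + θ • v) v w) :
    HasDerivAt (fun s : ℝ => f (u + s • v)) w θ := by
  rw [hasDerivAt_iff_tendsto_slope_zero]
  refine h.congr fun x => ?_
  rw [add_smul, add_assoc]

/-- If `f(u + h v) - f(u + h v')` is bounded by `|h| c` for small `h`, the directional derivatives
in the directions `v` and `v'` differ by at most `c`. -/
theorem HasDirDeriv.norm_sub_le {G : Type*} [NormedAddCommGroup G] [NormedSpace ℝ G] {f : E → G}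
    {u v v' : E} {w w' : G} {c : ℝ} (h : HasDirDeriv f u v w) (h' : HasDirDeriv f u v' w')
    (hc : ∀ᶠ h : ℝ in 𝓝 0, ‖f (u + h • v) - f (u + h • v')‖ ≤ |h| * c) : ‖w - w'‖ ≤ c := by
  refine le_of_tendsto (h.sub h').norm ?_
  filter_upwards [hc.filter_mono nhdsWithin_le_nhds, self_mem_nhdsWithin] with x hx hx0
  have hx0 : x ≠ 0 := hx0
  rw [← smul_sub, sub_sub_sub_cancel_right, norm_smul, norm_inv, Real.norm_eq_abs]
  rw [inv_mul_le_iff₀ (abs_pos.2 hx0)]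
  exact hx

/-- On a first countable space, Fréchet smoothness implies Michal-Bastiani smoothness. -/
theorem IsC1F.isC1MB [TopologicalSpace E] [IsTopologicalAddGroup E] [ContinuousSMul ℝ E] [FirstCountableTopology E]
    [IsTopologicalAddGroup F] [ContinuousSMul ℝ F] {f : E → F} {U : Set E} (h : IsC1F f U) :
    IsC1MB f U := by
  obtain ⟨hf, Df, hD, hDc⟩ := h
  refine ⟨hf, fun u v => Df u v, hD, ?_⟩
  rintro ⟨u, v⟩ ⟨hu, -⟩
  rw [ContinuousWithinAt, tendsto_iff_seq_tendsto]
  intro x hx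
  rw [tendsto_nhdsWithin_iff] at hx
  have hu' : Tendsto (fun k => (x k).1) atTop (𝓝[U] u) :=
    tendsto_nhdsWithin_iff.2 ⟨(continuous_fst.tendsto _).comp hx.1, hx.2.mono fun k hk => hk.1⟩
  have hv' : Tendsto (fun k => (x k).2) atTop (𝓝 v) := (continuous_snd.tendsto _).comp hx.1
  -- First countability reduces the claim to sequences. A convergent sequence of directions is
  -- bounded, so uniform convergence of the derivatives on bounded sets controls them at moving
  -- directions.
  have hb : Bornology.IsVonNBounded ℝ (range fun k => (x k).2) := hv'.isVonNBounded_range ℝ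
  have h1 : Tendsto (fun k => Df (x k).1 - Df u) atTop (𝓝 0) := by
    simpa using ((hDc u hu).tendsto.comp hu').sub_const (Df u)
  have h2 : Tendsto (fun k => (Df (x k).1 - Df u) (x k).2) atTop (𝓝 0) := by
    refine tendsto_def.2 fun W hW => ?_
    have := (ContinuousLinearMap.hasBasis_nhds_zero (σ := RingHom.id ℝ) (E := E)
      (F := F)).mem_of_mem (i := (range fun k => (x k).2, W)) ⟨hb, hW⟩
    filter_upwards [h1.eventually_mem this] with k hk
    exact hk _ (mem_range_self k)
  have h3 : Tendsto (fun k => Df u (x k).2) atTop (𝓝 (Df u v)) :=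
    ((Df u).continuous.tendsto v).comp hv'
  simpa [Function.comp_def] using h2.add h3

end DirectionalDerivatives

/-! ### Lipschitz tubes around compact sets. -/

section Tubes

variable {m : ℕ}

/-- `f` is defined and Lipschitz with respect to `nrm j` on the `δ`-balls around points of `K`. -/
def IsTube (U : Set (History m)) (f : History m → Fin m → ℝ) (K : Set (History m)) (j : ℕ)
    (δ L : ℝ) : Prop :=
  ∀ κ ∈ K, ∀ χ χ', nrm j (χ - κ) < δ → nrm j (χ' - κ) < δ →
    χ ∈ U ∧ ‖f χ - f χ'‖ ≤ L * nrm j (χ - χ')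

theorem IsTube.mono {U : Set (History m)} {f : History m → Fin m → ℝ} {K K' : Set (History m)}
    {j j' : ℕ} {δ δ' L L' : ℝ} (h : IsTube U f K j δ L) (hK : K' ⊆ K) (hj : j ≤ j')
    (hδ : δ' ≤ δ) (hL0 : 0 ≤ L) (hL : L ≤ L') : IsTube U f K' j' δ' L' :=
  fun κ hκ χ χ' h1 h2 => by
    obtain ⟨h3, h4⟩ := h κ (hK hκ) χ χ' (((nrm_mono hj _).trans_lt h1).trans_le hδ)
      (((nrm_mono hj _).trans_lt h2).trans_le hδ)
    refine ⟨h3, h4.trans ?_⟩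
    exact mul_le_mul hL (nrm_mono hj _) (nrm_nonneg _ _) (hL0.trans hL)

/-- Joint continuity at $(\kappa,0)$ bounds $Df(\chi)v$ by 1 for $\chi$ near $\kappa$ and $v$ small
in some seminorm. Homogeneity turns this into $\|Df(\chi)v\|\le C\,$`nrm j v`, and the mean value
inequality on segments gives the Lipschitz bound. -/
theorem exists_isTube_ball {U : Set (History m)} (hU : IsOpen U) {f : History m → Fin m → ℝ}
    (hf : IsC1MB f U) {κ : History m} (hκ : κ ∈ U) :
    ∃ (j : ℕ) (δ L : ℝ), 0 < δ ∧ 0 ≤ L ∧ IsTube U f {χ | nrm j (χ - κ) < δ} j δ L := by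
  obtain ⟨-, Df, hD, hDc⟩ := hf
  have h0 : Df κ 0 = 0 := by
    have := (hD κ hκ 0).smul 0
    rw [zero_smul, zero_smul] at this
    exact (hD κ hκ 0).unique this
  have hev : ∀ᶠ p : History m × History m in 𝓝 (κ, 0), p.1 ∈ U ∧ ‖Df p.1 p.2‖ < 1 := by
    have hn : U ×ˢ (univ : Set (History m)) ∈ 𝓝 (κ, (0 : History m)) :=
      prod_mem_nhds (hU.mem_nhds hκ) univ_mem
    have hc := (hDc.continuousAt hn).norm
    have := hc.eventually_lt (continuousAt_const (y := (1 : ℝ))) (by simp [h0])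
    filter_upwards [this, hn] with p hp hp' using ⟨hp'.1, hp⟩
  obtain ⟨⟨⟨j₁, r₁⟩, ⟨j₂, r₂⟩⟩, ⟨hr₁, hr₂⟩, hsub⟩ :=
    ((nhds_basis_nrm κ).prod_nhds (nhds_basis_nrm 0)).eventually_iff.1 hev
  simp only at hr₁ hr₂
  have hball : ∀ χ, nrm (max j₁ j₂) (χ - κ) < r₁ → χ ∈ U ∧ ∀ v, ‖Df χ v‖ ≤
      2 / r₂ * nrm (max j₁ j₂) v := by
    intro χ hχ
    have hχ1 : nrm j₁ (χ - κ) < r₁ := (nrm_mono (le_max_left _ _) _).trans_lt hχ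
    have hχU : χ ∈ U := (hsub (x := (χ, 0)) ⟨hχ1, by simpa using hr₂⟩).1
    refine ⟨hχU, fun v => ?_⟩
    -- The direction is scaled by $b^{-1}$ with $b$ strictly above the bound, since `nrm` is only a
    -- seminorm and may vanish at $v\neq0$.
    refine le_of_forall_gt_imp_ge_of_dense fun b hb => ?_
    have hn := nrm_nonneg (max j₁ j₂) v
    have hb0 : 0 < b := lt_of_le_of_lt (by positivity) hb
    have hs : nrm (max j₁ j₂) (b⁻¹ • v) < r₂ := by
      rw [nrm_smul, abs_inv, abs_of_pos hb0, inv_mul_lt_iff₀ hb0]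
      rw [div_mul_eq_mul_div, div_lt_iff₀ hr₂] at hb
      linarith
    have h1 := (hsub (x := (χ, b⁻¹ • v)) ⟨hχ1, by
      simpa using (nrm_mono (le_max_right j₁ j₂) _).trans_lt hs⟩).2
    have h2 : Df χ (b⁻¹ • v) = b⁻¹ • Df χ v :=
      (hD χ hχU _).unique ((hD χ hχU v).smul _)
    simp only at h1
    rw [h2, norm_smul, norm_inv, Real.norm_eq_abs, abs_of_pos hb0, inv_mul_lt_iff₀ hb0] at h1
    linarith
  refine ⟨max j₁ j₂, r₁ / 2, 2 / r₂, by positivity, by positivity, fun κ' hκ' χ χ' h1 h2 => ?_⟩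
  have hκ' : nrm (max j₁ j₂) (κ' - κ) < r₁ / 2 := hκ'
  have t1 := nrm_sub_le (max j₁ j₂) χ κ' κ
  have t2 := nrm_sub_le (max j₁ j₂) χ' κ' κ
  refine ⟨(hball χ (by linarith)).1, ?_⟩
  have hseg : ∀ θ ∈ Icc (0 : ℝ) 1, nrm (max j₁ j₂) (χ' + θ • (χ - χ') - κ) < r₁ := fun θ hθ => by
    have e : χ' + θ • (χ - χ') - κ = (1 - θ) • (χ' - κ) + θ • (χ - κ) := by module
    rw [e]
    refine (nrm_add_le _ _ _).trans_lt ?_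
    rw [nrm_smul, nrm_smul, abs_of_nonneg hθ.1, abs_of_nonneg (sub_nonneg.2 hθ.2)]
    nlinarith [hθ.1, hθ.2]
  have := norm_image_sub_le_of_norm_deriv_le_segment_01'
    (f := fun θ : ℝ => f (χ' + θ • (χ - χ'))) (C := 2 / r₂ * nrm (max j₁ j₂) (χ - χ'))
    (fun θ hθ => (hD _ (hball _ (hseg θ hθ)).1 (χ - χ')).hasDerivAt.hasDerivWithinAt)
    (fun θ hθ => (hball _ (hseg θ (Ico_subset_Icc_self hθ))).2 _)
  simpa using this

theorem exists_isTube {U : Set (History m)} (hU : IsOpen U) {f : History m → Fin m → ℝ}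
    (hf : IsC1MB f U) {K : Set (History m)} (hK : IsCompact K) (hKU : K ⊆ U) :
    ∃ (j : ℕ) (δ L : ℝ), 0 < δ ∧ 0 ≤ L ∧ IsTube U f K j δ L := by
  refine hK.induction_on (p := fun K => ∃ (j : ℕ) (δ L : ℝ), 0 < δ ∧ 0 ≤ L ∧ IsTube U f K j δ L)
    ⟨0, 1, 0, one_pos, le_rfl, fun κ hκ => hκ.elim⟩ ?_ ?_ ?_
  · rintro s t hst ⟨j, δ, L, hδ, hL, h⟩
    exact ⟨j, δ, L, hδ, hL, h.mono hst le_rfl le_rfl hL le_rfl⟩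
  · rintro s t ⟨j, δ, L, hδ, hL, h⟩ ⟨j', δ', L', hδ', hL', h'⟩
    refine ⟨max j j', min δ δ', max L L', lt_min hδ hδ', le_max_of_le_left hL, ?_⟩
    rintro κ (hκ | hκ)
    · exact (h.mono Subset.rfl (le_max_left _ _) (min_le_left _ _) hL (le_max_left _ _)) κ hκ
    · exact (h'.mono Subset.rfl (le_max_right _ _) (min_le_right _ _) hL' (le_max_right _ _)) κ hκ
  · intro κ hκ
    obtain ⟨j, δ, L, hδ, hL, h⟩ := exists_isTube_ball hU hf (hKU hκ)
    exact ⟨_, mem_nhdsWithin_of_mem_nhds (eventually_nrm_sub_lt j κ hδ), j, δ, L, hδ, hL, h⟩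

end Tubes

/-! ### Solutions on compact intervals, and uniqueness. -/

section Solutions

variable {m : ℕ}

/-- `z` is a solution of `z'(t) = f(z_t)` on `[0, S]`. -/
def IsSol (U : Set (History m)) (f : History m → Fin m → ℝ) (S : ℝ) (z : C(ℝ, Fin m → ℝ)) :
    Prop :=
  ∀ t ∈ Icc 0 S, seg z t ∈ U ∧ HasDerivWithinAt z (f (seg z t)) (Icc 0 S) t

theorem IsSol.mono {U : Set (History m)} {f : History m → Fin m → ℝ} {S S' : ℝ}
    {z : C(ℝ, Fin m → ℝ)} (h : IsSol U f S z) (hS : S' ≤ S) : IsSol U f S' z :=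
  fun t ht => ⟨(h t ⟨ht.1, ht.2.trans hS⟩).1,
    (h t ⟨ht.1, ht.2.trans hS⟩).2.mono (Icc_subset_Icc_right hS)⟩

theorem IsSol.congr {U : Set (History m)} {f : History m → Fin m → ℝ} {S : ℝ}
    {z w : C(ℝ, Fin m → ℝ)} (h : IsSol U f S z) (hw : ∀ s ≤ S, w s = z s) : IsSol U f S w :=
  fun t ht => by
    have e : seg w t = seg z t := seg_congr fun s hs => hw s (hs.trans ht.2)
    rw [e]
    exact ⟨(h t ht).1, (h t ht).2.congr (fun s hs => hw s hs.2) (hw t ht.2)⟩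

/-- Gronwall with $a=\eta=0$, applied on all of $[0,S]$ at once, so no continuation argument along
the set of coincidence is needed. -/
theorem IsSol.eq_of_seg_zero_eq {U : Set (History m)} (hU : IsOpen U) {f : History m → Fin m → ℝ}
    (hf : IsC1MB f U) {S : ℝ} {z w : C(ℝ, Fin m → ℝ)} (hz : IsSol U f S z) (hw : IsSol U f S w)
    (h0 : seg z 0 = seg w 0) {s : ℝ} (hs : s ≤ S) : z s = w s := by
  rcases le_total s 0 with hs0 | hs0
  · exact apply_eq_of_seg_eq h0 hs0
  have hzw : ∀ v : C(ℝ, Fin m → ℝ), IsCompact (seg v '' Icc 0 S) := fun v =>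
    isCompact_Icc.image (continuous_seg v)
  set K := seg z '' Icc 0 S ∪ seg w '' Icc 0 S with hKdef
  have hK : IsCompact K := (hzw z).union (hzw w)
  have hKU : K ⊆ U := by
    rintro _ (⟨t, ht, rfl⟩ | ⟨t, ht, rfl⟩)
    exacts [(hz t ht).1, (hw t ht).1]
  obtain ⟨j, δ, L, hδ, hL, htube⟩ := exists_isTube hU hf hK hKU
  obtain ⟨M, hM⟩ := hK.exists_bound_of_continuousOn (hf.1.mono hKU)
  -- The tube gives a Lipschitz bound only for segments closer than $\delta$. At distance at least
  -- $\delta$, the bound $2M$ for the difference of the values is at most $2M/\delta$ times the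
  -- distance.
  set L' := max L (2 * M / δ)
  have hL' : 0 ≤ L' := le_max_of_le_left hL
  have hb : ∀ t ∈ Icc 0 S, ‖f (seg z t) - f (seg w t)‖ ≤ L' * nrm j (seg (z - w) t) + 0 := by
    intro t ht
    have hzK : seg z t ∈ K := Or.inl (mem_image_of_mem _ ht)
    have hwK : seg w t ∈ K := Or.inr (mem_image_of_mem _ ht)
    rw [add_zero, seg_sub]
    rcases lt_or_ge (nrm j (seg z t - seg w t)) δ with h | h
    · refine (htube _ hwK _ _ h (by simpa using hδ)).2.trans ?_
      exact mul_le_mul_of_nonneg_right (le_max_left _ _) (nrm_nonneg _ _)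
    · have h1 := norm_sub_le (f (seg z t)) (f (seg w t))
      have h2 := hM _ hzK
      have h3 := hM _ hwK
      have hM0 : 0 ≤ M := (norm_nonneg _).trans h2
      calc ‖f (seg z t) - f (seg w t)‖ ≤ 2 * M / δ * δ := by
            rw [div_mul_cancel₀ _ hδ.ne']; linarith
        _ ≤ L' * nrm j (seg z t - seg w t) :=
            mul_le_mul (le_max_right _ _) h hδ.le hL'
  have := norm_le_of_delay_gronwall (d := z - w) hL' le_rfl le_rfl
    (fun t ht => (hz t ht).2.sub (hw t ht).2) hb
    (fun s hs _ => by simp [apply_eq_of_seg_eq h0 hs]) ⟨hs0, hs⟩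
  simpa [sub_eq_zero] using this

end Solutions

/-! ### Truncation of histories. -/

section Clip

variable {m : ℕ}

/-- Componentwise truncation at `±r`. -/
def clip (r : ℝ) (x : Fin m → ℝ) : Fin m → ℝ := fun i => max (-r) (min r (x i))

@[fun_prop]
theorem continuous_clip (r : ℝ) : Continuous (clip r : (Fin m → ℝ) → Fin m → ℝ) := by
  unfold clip
  fun_prop

theorem norm_clip_le {r : ℝ} (hr : 0 ≤ r) (x : Fin m → ℝ) : ‖clip r x‖ ≤ r :=
  (pi_norm_le_iff_of_nonneg hr).2 fun i => by
    rw [Real.norm_eq_abs, abs_le]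
    exact ⟨le_max_left _ _, max_le (by linarith) (min_le_left _ _)⟩

theorem clip_of_norm_le {r : ℝ} {x : Fin m → ℝ} (h : ‖x‖ ≤ r) : clip r x = x := by
  ext i
  have := (norm_le_pi_norm x i).trans h
  rw [Real.norm_eq_abs, abs_le] at this
  rw [clip, min_eq_right this.2, max_eq_right this.1]

theorem norm_clip_sub_clip_le (r : ℝ) (x y : Fin m → ℝ) : ‖clip r x - clip r y‖ ≤ ‖x - y‖ :=
  (pi_norm_le_iff_of_nonneg (norm_nonneg _)).2 fun i => by
    refine le_trans ?_ (norm_le_pi_norm (x - y) i)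
    simp only [Pi.sub_apply, Real.norm_eq_abs, clip]
    refine (abs_max_sub_max_le_max _ _ _ _).trans ?_
    simp only [sub_self, abs_zero]
    refine max_le (abs_nonneg _) ((abs_min_sub_min_le_max _ _ _ _).trans ?_)
    simp

/-- Truncation of histories. -/
def clipHistory (r : ℝ) (ψ : History m) : History m :=
  (⟨clip r, continuous_clip r⟩ : C(Fin m → ℝ, Fin m → ℝ)).comp ψ

@[fun_prop]
theorem continuous_clipHistory (r : ℝ) : Continuous (clipHistory r : History m → History m) :=
  ContinuousMap.continuous_postcomp _

theorem nrm_clipHistory_le {r : ℝ} (hr : 0 ≤ r) (j : ℕ) (ψ : History m) :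
    nrm j (clipHistory r ψ) ≤ r :=
  nrm_le hr fun _ _ => norm_clip_le hr _

theorem nrm_clipHistory_sub_le (r : ℝ) (j : ℕ) (ψ χ : History m) :
    nrm j (clipHistory r ψ - clipHistory r χ) ≤ nrm j (ψ - χ) :=
  nrm_le (nrm_nonneg _ _) fun _ hs =>
    (norm_clip_sub_clip_le r _ _).trans (norm_apply_le_nrm (ψ - χ) hs)

/-- Truncation may change $\psi$ before time $-j$, so equality can fail. A vanishing seminorm is
enough, because in a tube $f$ does not distinguish histories at `nrm j`-distance zero. -/
theorem nrm_clipHistory_sub_self {r : ℝ} {j : ℕ} {ψ : History m} (h : nrm j ψ ≤ r) :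
    nrm j (clipHistory r ψ - ψ) = 0 :=
  le_antisymm (nrm_le le_rfl fun s hs => by
    have := clip_of_norm_le ((norm_apply_le_nrm ψ hs).trans h)
    simp [clipHistory, this]) (nrm_nonneg _ _)

end Clip

/-! ### Flow boxes: simultaneous existence for all nearby initial data. -/

section FlowBox

variable {m : ℕ}

/-- All solutions starting near `ψ₀` exist on `[0, S]`, and stay in a tube around the curve `c`
in which `f` is Lipschitz. -/
structure IsFlowBox (U : Set (History m)) (f : History m → Fin m → ℝ) (ψ₀ : History m) (S : ℝ)
    (c : C(ℝ, Fin m → ℝ)) (j : ℕ) (δ L ρ : ℝ) : Prop where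
  pos_radius : 0 < ρ
  lip_nonneg : 0 ≤ L
  tube : IsTube U f (seg c '' Icc 0 S) j δ L
  exists_sol : ∀ ψ, nrm j (ψ - ψ₀) < ρ → ∃ z, seg z 0 = ψ ∧ IsSol U f S z ∧
    ∀ t ∈ Icc 0 S, nrm j (seg z t - seg c t) < δ

/-- The continuous map which equals `y` on `(-∞, T]` and is constant on `[T, ∞)`. -/
def freeze (y : C(ℝ, Fin m → ℝ)) (T : ℝ) : C(ℝ, Fin m → ℝ) where
  toFun t := y (min t T)
  continuous_toFun := by fun_prop

theorem freeze_of_le (y : C(ℝ, Fin m → ℝ)) {T t : ℝ} (h : t ≤ T) : freeze y T t = y t := by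
  simp [freeze, h]

theorem freeze_of_ge (y : C(ℝ, Fin m → ℝ)) {T t : ℝ} (h : T ≤ t) : freeze y T t = y T := by
  simp [freeze, h]

/-- The truncated equation `F` has solutions on a longer interval. Up to time $T$ the frozen curve
$c$ solves it too, and Gronwall keeps $z-c$ below $\delta/4$. After $T$ the curve is constant and
$z$ has bounded speed, so for a short time $z-c$ stays below $\delta/2$. There the truncation is
invisible and $z$ solves the original equation. -/
theorem exists_isFlowBox {U : Set (History m)} (hU : IsOpen U) {f : History m → Fin m → ℝ}
    (hf : IsC1MB f U) {T : ℝ} (hT : 0 ≤ T) {y : C(ℝ, Fin m → ℝ)} (hy : IsSol U f T y) :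
    ∃ S > T, ∃ c j δ L ρ, IsFlowBox U f (seg y 0) S c j δ L ρ := by
  set c := freeze y T with hcdef
  have hc : IsSol U f T c := hy.congr fun s hs => freeze_of_le y hs
  have hc0 : seg c 0 = seg y 0 := seg_congr fun s hs => freeze_of_le y (hs.trans hT)
  have hcU : ∀ᶠ t in 𝓝 T, seg c t ∈ U :=
    (continuous_seg c).continuousAt.eventually_mem (hU.mem_nhds (hc T ⟨hT, le_rfl⟩).1)
  obtain ⟨e, he, hball⟩ := Metric.eventually_nhds_iff.1 hcU
  have hKU : seg c '' Icc 0 (T + e / 2) ⊆ U := by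
    rintro _ ⟨t, ht, rfl⟩
    rcases le_total t T with h | h
    · exact (hc t ⟨ht.1, h⟩).1
    · refine hball ?_
      rw [Real.dist_eq, abs_of_nonneg (by linarith)]
      linarith [ht.2]
  have hK : IsCompact (seg c '' Icc 0 (T + e / 2)) := isCompact_Icc.image (continuous_seg c)
  obtain ⟨j, δ, L, hδ, hL, htube⟩ := exists_isTube hU hf hK hKU
  obtain ⟨M, hM⟩ := hK.exists_bound_of_continuousOn (hf.1.mono hKU)
  have hr : 0 ≤ δ / 2 := by positivity
  -- Only the deviation from the curve is truncated. The argument of $f$ thus stays in the tube for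
  -- every $\chi$, which makes `F` globally Lipschitz in $\chi$ for each $t\in[0,T+e/2]$.
  let F : ℝ → History m → Fin m → ℝ := fun t χ =>
    f (seg c t + clipHistory (δ / 2) (χ - seg c t))
  have hin : ∀ t χ, nrm j (seg c t + clipHistory (δ / 2) (χ - seg c t) - seg c t) < δ :=
    fun t χ => by
      rw [add_sub_cancel_left]
      exact (nrm_clipHistory_le hr j _).trans_lt (by linarith)
  have hFLip : ∀ t ∈ Icc 0 (T + e / 2), ∀ χ χ', ‖F t χ - F t χ'‖ ≤ L * nrm j (χ - χ') := by
    intro t ht χ χ'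
    refine (htube _ (mem_image_of_mem _ ht) _ _ (hin t χ) (hin t χ')).2.trans ?_
    refine mul_le_mul_of_nonneg_left ?_ hL
    rw [add_sub_add_left_eq_sub]
    refine (nrm_clipHistory_sub_le _ _ _ _).trans_eq ?_
    rw [sub_sub_sub_cancel_right]
  have hFcont : ∀ z : C(ℝ, Fin m → ℝ),
      ContinuousOn (fun t => F t (seg z t)) (Icc 0 (T + e / 2)) := by
    intro z
    refine hf.1.comp (Continuous.continuousOn (by fun_prop)) fun t ht => ?_
    exact (htube _ (mem_image_of_mem _ ht) _ _ (hin t _) (hin t (seg z t))).1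
  have hFc : ∀ t, F t (seg c t) = f (seg c t) := fun t => by
    have : clipHistory (δ / 2) (0 : History m) = 0 := by
      ext1 s
      exact clip_of_norm_le (by simpa using hr)
    simp only [F, sub_self, this, add_zero]
  have hM0 : 0 ≤ M := (norm_nonneg _).trans (hM _ (mem_image_of_mem _ ⟨le_rfl, by positivity⟩))
  have hFM : ∀ t ∈ Icc 0 (T + e / 2), ∀ χ, ‖F t χ‖ ≤ M + L * δ := by
    intro t ht χ
    have h1 := (htube _ (mem_image_of_mem _ ht) _ (seg c t) (hin t χ) (by simpa using hδ)).2
    have h2 : ‖F t χ‖ ≤ ‖F t χ - f (seg c t)‖ + ‖f (seg c t)‖ := by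
      simpa using norm_add_le (F t χ - f (seg c t)) (f (seg c t))
    have h3 := hM _ (mem_image_of_mem _ ht)
    have h4 := mul_le_mul_of_nonneg_left (hin t χ).le hL
    have h5 : ‖F t χ - f (seg c t)‖ ≤ L * δ := h1.trans h4
    linarith
  -- The speed of $z$ is at most $M+L\delta$, so it moves by at most $\delta/4$ during
  -- $[T,T+\varepsilon]$. The summand 1 keeps the denominator positive.
  set ε := min (e / 2) (δ / 4 / (M + L * δ + 1)) with hε
  have hε0 : 0 < ε := lt_min (by positivity) (by positivity)
  have hεe : T + ε ≤ T + e / 2 := by linarith [min_le_left (e / 2) (δ / 4 / (M + L * δ + 1))]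
  have hεM : (M + L * δ) * ε ≤ δ / 4 := by
    have h1 : ε ≤ δ / 4 / (M + L * δ + 1) := min_le_right _ _
    rw [le_div_iff₀ (by positivity)] at h1
    linarith
  set G := gronwallConst L T
  have hG : 1 ≤ G := one_le_gronwallConst hL hT
  refine ⟨T + ε, by linarith, c, j, δ, L, δ / 4 / G, by positivity, hL,
    htube.mono (image_mono (Icc_subset_Icc_right hεe)) le_rfl le_rfl hL le_rfl, fun ψ hψ => ?_⟩
  obtain ⟨z, hz0, hz⟩ := exists_solution_of_lipschitz (by positivity : 0 ≤ T + e / 2) hL F hFcont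
    hFLip ψ
  have hpast : ∀ s ≤ 0, -(j : ℝ) ≤ s → ‖(z - c) s‖ ≤ nrm j (ψ - seg y 0) := fun s hs hs' => by
    have := norm_apply_le_nrm_seg (k := j) (z - c) hs (by linarith)
    rwa [seg_sub, hz0, hc0] at this
  have hpres : ∀ t ∈ Icc 0 T, ‖(z - c) t‖ ≤ δ / 4 := fun t ht => by
    have h1 := norm_le_of_delay_gronwall (d := z - c) (j := j) (η := 0) (S := T) hL
      (nrm_nonneg j (ψ - seg y 0)) le_rfl
      (fun t ht => ((hz t ⟨ht.1, by linarith [ht.2]⟩).mono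
        (Icc_subset_Icc_right (by linarith))).sub (hc t ht).2)
      (fun t ht => by
        rw [add_zero, ← hFc t]
        exact hFLip t ⟨ht.1, by linarith [ht.2]⟩ _ _) hpast ht
    rw [lt_div_iff₀ (by positivity)] at hψ
    rw [add_zero] at h1
    linarith
  have hfut : ∀ t ∈ Icc T (T + ε), ‖(z - c) t‖ ≤ δ / 2 := fun t ht => by
    have h1 := norm_image_sub_le_of_norm_deriv_right_le_segment (f := z)
      (f' := fun t => F t (seg z t)) (C := M + L * δ) (a := T) (b := T + ε) (by fun_prop)
      (fun x hx => (hz x ⟨hT.trans hx.1, hx.2.le.trans hεe⟩).mono_of_mem_nhdsWithin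
        (Icc_mem_nhdsGE_of_mem ⟨hT.trans hx.1, hx.2.trans_le hεe⟩))
      (fun x hx => hFM x ⟨hT.trans hx.1, hx.2.le.trans hεe⟩ _) t ht
    have h2 := hpres T ⟨hT, le_rfl⟩
    have h3 : (z - c) t = (z - c) T + (z t - z T) := by
      simp only [ContinuousMap.sub_apply, hcdef, freeze_of_ge y ht.1, freeze_of_ge y le_rfl]
      abel
    have h4 : (M + L * δ) * (t - T) ≤ (M + L * δ) * ε := by
      gcongr
      linarith [ht.2]
    rw [h3]
    refine (norm_add_le _ _).trans ?_
    linarith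
  have hnear : ∀ t ∈ Icc 0 (T + ε), nrm j (seg z t - seg c t) ≤ δ / 2 := fun t ht => by
    rw [← seg_sub]
    refine nrm_seg_le hr fun s hs hs' => ?_
    rcases le_total s 0 with h | h
    · refine (hpast s h (by linarith [ht.1])).trans (hψ.le.trans ?_)
      refine (div_le_self (by positivity) hG).trans (by linarith)
    rcases le_total s T with h' | h'
    · exact (hpres s ⟨h, h'⟩).trans (by linarith)
    · exact hfut s ⟨h', hs.trans ht.2⟩
  refine ⟨z, hz0, fun t ht => ?_, fun t ht => (hnear t ht).trans_lt (by linarith)⟩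
  have ht' : t ∈ Icc 0 (T + e / 2) := ⟨ht.1, ht.2.trans hεe⟩
  have hzt : nrm j (seg z t - seg c t) < δ := (hnear t ht).trans_lt (by linarith)
  obtain ⟨h1, h2⟩ := htube _ (mem_image_of_mem _ ht') (seg z t) _ hzt (hin t (seg z t))
  refine ⟨h1, ?_⟩
  have h3 : f (seg z t) = F t (seg z t) := by
    rw [← sub_eq_zero, ← norm_le_zero_iff]
    refine h2.trans_eq ?_
    have e : seg z t - (seg c t + clipHistory (δ / 2) (seg z t - seg c t)) =
      (seg z t - seg c t) - clipHistory (δ / 2) (seg z t - seg c t) := by abel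
    rw [e, nrm_sub_comm, nrm_clipHistory_sub_self (hnear t ht), mul_zero]
  rw [h3]
  exact (hz t ht').mono (Icc_subset_Icc_right hεe)

end FlowBox

end DelayEquation

namespace DelayEquation

/-! ### Identifying the defined escape time, maximal solution and flow. -/

section Bridge

variable {m : ℕ} {U : Set (History m)} {f : History m → Fin m → ℝ}

theorem exists_isSol_of_isAutSolution {φ : History m} {T : ℝ} (hT : 0 ≤ T) {y : ℝ → Fin m → ℝ}
    (h : IsAutSolution U f φ T y) :
    ∃ z : C(ℝ, Fin m → ℝ), IsSol U f T z ∧ seg z 0 = φ ∧ ∀ s ≤ T, z s = y s := by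
  obtain ⟨hy, hφ⟩ := h
  -- The segment at the final time $T$ contains all values of $y$ on $(-\infty,T]$ and is
  -- continuous, so the globally continuous $z$ can be read off from it.
  obtain ⟨ψ, hψ, -, -⟩ := hy T ⟨hT, le_rfl⟩
  let z : C(ℝ, Fin m → ℝ) :=
    ⟨fun t => ψ ⟨min t T - T, mem_Iic.2 (sub_nonpos.2 (min_le_right _ _))⟩, by fun_prop⟩
  have hz : ∀ s ≤ T, z s = y s := fun s hs => by
    have := hψ ⟨min s T - T, mem_Iic.2 (sub_nonpos.2 (min_le_right _ _))⟩
    simpa [z, hs] using this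
  have hseg : ∀ t ≤ T, ∀ χ : History m, IsSegment y t χ → seg z t = χ := fun t ht χ hχ => by
    ext1 s
    have hs : (s : ℝ) ≤ 0 := s.2
    rw [hχ s, seg_apply, hz _ (by linarith)]
  refine ⟨z, fun t ht => ?_, hseg 0 hT φ hφ, hz⟩
  obtain ⟨χ, hχ, hU, hd⟩ := hy t ht
  rw [hseg t ht.2 χ hχ]
  exact ⟨hU, hd.congr (fun s hs => hz s hs.2) (hz t ht.2)⟩

theorem IsSol.isAutSolution {T : ℝ} {z : C(ℝ, Fin m → ℝ)} (h : IsSol U f T z) :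
    IsAutSolution U f (seg z 0) T z :=
  ⟨fun t ht => ⟨seg z t, fun _ => rfl, (h t ht).1, (h t ht).2⟩, fun _ => rfl⟩

theorem lt_escapeTime_iff {ψ : History m} {t : ℝ} :
    (t : EReal) < escapeTime U f ψ ↔
      ∃ T > t, 0 < T ∧ ∃ z, IsSol U f T z ∧ seg z 0 = ψ := by
  rw [escapeTime, lt_sSup_iff]
  constructor
  · rintro ⟨_, ⟨T, hT, rfl, y, hy⟩, htT⟩
    obtain ⟨z, hz, hz0, -⟩ := exists_isSol_of_isAutSolution hT.le hy
    exact ⟨T, by exact_mod_cast htT, hT, z, hz, hz0⟩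
  · rintro ⟨T, htT, hT, z, hz, rfl⟩
    exact ⟨T, ⟨T, hT, rfl, z, hz.isAutSolution⟩, by exact_mod_cast htT⟩

theorem mem_flowDom_iff {ψ : History m} {t : ℝ} :
    (t, ψ) ∈ flowDom U f ↔ 0 ≤ t ∧ ∃ T > t, ∃ z, IsSol U f T z ∧ seg z 0 = ψ := by
  simp only [flowDom, mem_ofPred_eq, lt_escapeTime_iff]
  constructor
  · rintro ⟨h0, -, T, hT, -, h⟩
    exact ⟨h0, T, hT, h⟩
  · rintro ⟨h0, T, hT, z, hz, rfl⟩
    have hT0 : 0 < T := h0.trans_lt hT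
    exact ⟨h0, (hz 0 ⟨le_rfl, hT0.le⟩).1, T, hT, hT0, z, hz, rfl⟩

/-- By uniqueness, the solution chosen in `maxSolution` does not matter, although the choice may
vary with the time. -/
theorem maxSolution_eq (hU : IsOpen U) (hf : IsC1MB f U) {T : ℝ} (hT : 0 < T)
    {z : C(ℝ, Fin m → ℝ)} (hz : IsSol U f T z) {s : ℝ} (hs : s < T) :
    maxSolution U f (seg z 0) s = z s := by
  have h : ∃ y : ℝ → Fin m → ℝ, ∃ T : ℝ, 0 < T ∧ s < T ∧ IsAutSolution U f (seg z 0) T y :=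
    ⟨z, T, hT, hs, hz.isAutSolution⟩
  rw [maxSolution, dif_pos h]
  obtain ⟨T', hT', hs', hy⟩ := h.choose_spec
  obtain ⟨w, hw, hw0, hwy⟩ := exists_isSol_of_isAutSolution hT'.le hy
  rw [← hwy s hs'.le]
  exact (hw.mono (min_le_left T' T)).eq_of_seg_zero_eq hU hf (hz.mono (min_le_right T' T)) hw0
    (le_min hs'.le hs.le)

theorem isSegment_maxSolution (hU : IsOpen U) (hf : IsC1MB f U) {T : ℝ} (hT : 0 < T)
    {z : C(ℝ, Fin m → ℝ)} (hz : IsSol U f T z) {t : ℝ} (ht : t < T) :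
    IsSegment (maxSolution U f (seg z 0)) t (seg z t) := fun s => by
  have hs : (s : ℝ) ≤ 0 := s.2
  rw [maxSolution_eq hU hf hT hz (by linarith), seg_apply]

theorem flow_eq (hU : IsOpen U) (hf : IsC1MB f U) {T : ℝ} (hT : 0 < T)
    {z : C(ℝ, Fin m → ℝ)} (hz : IsSol U f T z) {t : ℝ} (ht : t < T) :
    flow U f t (seg z 0) = seg z t := by
  have h : ∃ ψ : History m, IsSegment (maxSolution U f (seg z 0)) t ψ :=
    ⟨_, isSegment_maxSolution hU hf hT hz ht⟩
  rw [flow, dif_pos h]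
  ext1 s
  rw [h.choose_spec s, isSegment_maxSolution hU hf hT hz ht s]

/-- On $[0,0]$ any extension of $\psi$ is a solution, as every vector is a derivative within a
single point. A flow box around it reaches strictly positive times. -/
theorem exists_isSol (hU : IsOpen U) (hf : IsC1MB f U) {ψ : History m} (hψ : ψ ∈ U) :
    ∃ T > 0, ∃ z, IsSol U f T z ∧ seg z 0 = ψ := by
  let y : C(ℝ, Fin m → ℝ) := ⟨fun t => ψ ⟨min t 0, mem_Iic.2 (min_le_right _ _)⟩, by fun_prop⟩
  have hy0 : seg y 0 = ψ := by
    ext1 s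
    have hs : (s : ℝ) ≤ 0 := s.2
    simp [y, hs]
  have hy : IsSol U f 0 y := fun t ht => by
    obtain rfl : t = 0 := le_antisymm ht.2 ht.1
    refine ⟨hy0 ▸ hψ, ?_⟩
    rw [Icc_self]
    exact HasFDerivWithinAt.singleton
  obtain ⟨S, hS, c, j, δ, L, ρ, hbox⟩ := exists_isFlowBox hU hf le_rfl hy
  obtain ⟨z, hz0, hz, -⟩ := hbox.exists_sol ψ (by simpa [hy0] using hbox.pos_radius)
  exact ⟨S, hS, z, hz, hz0⟩

theorem zero_mem_flowDom (hU : IsOpen U) (hf : IsC1MB f U) {ψ : History m} (hψ : ψ ∈ U) :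
    (0, ψ) ∈ flowDom U f :=
  mem_flowDom_iff.2 ⟨le_rfl, exists_isSol hU hf hψ⟩

theorem flow_zero (hU : IsOpen U) (hf : IsC1MB f U) {ψ : History m} (hψ : ψ ∈ U) :
    flow U f 0 ψ = ψ := by
  obtain ⟨T, hT, z, hz, rfl⟩ := exists_isSol hU hf hψ
  exact flow_eq hU hf hT hz hT

theorem flow_mem (hU : IsOpen U) (hf : IsC1MB f U) {t : ℝ} {ψ : History m}
    (h : (t, ψ) ∈ flowDom U f) : flow U f t ψ ∈ U := by
  obtain ⟨h0, T, hT, z, hz, rfl⟩ := mem_flowDom_iff.1 h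
  rw [flow_eq hU hf (h0.trans_lt hT) hz hT]
  exact (hz t ⟨h0, hT.le⟩).1

theorem isSegment_maxSolution_flow (hU : IsOpen U) (hf : IsC1MB f U) {t : ℝ} {ψ : History m}
    (h : (t, ψ) ∈ flowDom U f) : IsSegment (maxSolution U f ψ) t (flow U f t ψ) := by
  obtain ⟨h0, T, hT, z, hz, rfl⟩ := mem_flowDom_iff.1 h
  rw [flow_eq hU hf (h0.trans_lt hT) hz hT]
  exact isSegment_maxSolution hU hf (h0.trans_lt hT) hz hT

theorem isMaximalSolution_maxSolution (hU : IsOpen U) (hf : IsC1MB f U) {ψ : History m}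
    (hψ : ψ ∈ U) :
    IsMaximalSolution (autDom U) (autRhs f) 0 ψ (escapeTime U f ψ) (maxSolution U f ψ) := by
  have hpos : ((0 : ℝ) : EReal) < escapeTime U f ψ := by
    obtain ⟨T, hT, h⟩ := exists_isSol hU hf hψ
    exact lt_escapeTime_iff.2 ⟨T, hT, hT, h⟩
  have hres : ∀ (te' : EReal) (x' : ℝ → Fin m → ℝ),
      IsIVPSolution (autDom U) (autRhs f) 0 ψ te' x' → ∀ r : ℝ, (r : EReal) < te' →
      IsAutSolution U f ψ r x' := fun te' x' hx' r hr =>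
    ⟨fun t ht => by
      have htr : (t : EReal) < te' := lt_of_le_of_lt (by exact_mod_cast ht.2) hr
      obtain ⟨χ, h1, h2, h3⟩ := hx'.2.1 t ⟨ht.1, htr⟩
      exact ⟨χ, h1, h2, h3.mono fun s hs =>
        ⟨hs.1, lt_of_le_of_lt (by exact_mod_cast hs.2) hr⟩⟩, hx'.2.2⟩
  refine ⟨⟨hpos, fun t ht => ?_, ?_⟩, fun te' x' hx' => ⟨?_, fun s hs => ?_⟩⟩
  · obtain ⟨T, hT, hT0, z, hz, rfl⟩ := lt_escapeTime_iff.1 ht.2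
    have hzt := hz t ⟨ht.1, hT.le⟩
    refine ⟨seg z t, isSegment_maxSolution hU hf hT0 hz hT, hzt.1, ?_⟩
    have hmem : Icc 0 T ∈ 𝓝[{t : ℝ | 0 ≤ t ∧ (t : EReal) < escapeTime U f (seg z 0)}] t := by
      filter_upwards [self_mem_nhdsWithin, mem_nhdsWithin_of_mem_nhds (Iio_mem_nhds hT)]
        with s hs hs' using ⟨hs.1, le_of_lt hs'⟩
    refine (hzt.2.mono_of_mem_nhdsWithin hmem).congr_of_eventuallyEq ?_
      (maxSolution_eq hU hf hT0 hz hT)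
    filter_upwards [mem_nhdsWithin_of_mem_nhds (Iio_mem_nhds hT)] with s hs
      using maxSolution_eq hU hf hT0 hz hs
  · obtain ⟨T, hT, z, hz, rfl⟩ := exists_isSol hU hf hψ
    exact isSegment_maxSolution hU hf hT hz hT
  · by_contra! hlt
    obtain ⟨r, hr, hr'⟩ := EReal.lt_iff_exists_real_btwn.1 hlt
    have hr0 : 0 < r := by exact_mod_cast hpos.trans hr
    exact hr.not_ge (le_sSup ⟨r, hr0, rfl, x', hres te' x' hx' r hr'⟩)
  -- The time $s$ may be negative, whereas a comparison interval $[0,r]$ needs $r>0$.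
  · have : ((max s 0 : ℝ) : EReal) < te' := by
      rcases max_choice s 0 with h | h <;> rw [h]
      exacts [hs, hx'.1]
    obtain ⟨r, hr, hr'⟩ := EReal.lt_iff_exists_real_btwn.1 this
    have hr : max s 0 < r := by exact_mod_cast hr
    have hr0 : 0 < r := (le_max_right _ _).trans_lt hr
    have hsr : s < r := (le_max_left _ _).trans_lt hr
    obtain ⟨z, hz, hz0, hzx⟩ := exists_isSol_of_isAutSolution hr0.le (hres te' x' hx' r hr')
    rw [← hzx s hsr.le, ← hz0, maxSolution_eq hU hf hr0 hz hsr]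

end Bridge

/-! ### Translation and concatenation of solutions; the semiflow law. -/

section Semiflow

variable {m : ℕ} {U : Set (History m)} {f : History m → Fin m → ℝ}

theorem hasDerivWithinAt_comp_const_add {g : ℝ → Fin m → ℝ} {g' : Fin m → ℝ} {s s' : Set ℝ}
    {a x : ℝ} (h : HasDerivWithinAt g g' s (a + x)) (hs : MapsTo (fun r => a + r) s' s) :
    HasDerivWithinAt (fun r => g (a + r)) g' s' x := by
  simpa [Function.comp_def] using
    HasDerivWithinAt.scomp x h ((hasDerivWithinAt_id x s').const_add a) hs

/-- The translate `r ↦ z(t + r)`. -/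
def shift (z : C(ℝ, Fin m → ℝ)) (t : ℝ) : C(ℝ, Fin m → ℝ) := ⟨fun r => z (t + r), by fun_prop⟩

theorem seg_shift (z : C(ℝ, Fin m → ℝ)) (t r : ℝ) : seg (shift z t) r = seg z (t + r) := by
  ext1 s
  simp [shift, add_assoc]

theorem IsSol.shift {T : ℝ} {z : C(ℝ, Fin m → ℝ)} (h : IsSol U f T z) {t : ℝ} (ht : 0 ≤ t) :
    IsSol U f (T - t) (shift z t) := fun r hr => by
  have := h (t + r) ⟨add_nonneg ht hr.1, by linarith [hr.2]⟩
  rw [seg_shift]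
  exact ⟨this.1, hasDerivWithinAt_comp_const_add this.2 fun s hs =>
    ⟨add_nonneg ht hs.1, by linarith [hs.2]⟩⟩

theorem exists_isSol_concat (hU : IsOpen U) (hf : IsC1MB f U) {t T S : ℝ} (ht : 0 ≤ t)
    (hT : t < T) (hS : 0 < S) {z x : C(ℝ, Fin m → ℝ)} (hz : IsSol U f T z) (hx : IsSol U f S x)
    (hzx : seg x 0 = seg z t) :
    ∃ c, IsSol U f (t + S) c ∧ seg c 0 = seg z 0 ∧ ∀ r ≤ S, seg c (t + r) = seg x r := by
  have h0 : x 0 = z t := by simpa using DFunLike.congr_fun hzx ⟨0, self_mem_Iic⟩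
  let c : C(ℝ, Fin m → ℝ) := ⟨fun r => if r ≤ t then z r else x (r - t), by
    refine Continuous.if_le (by fun_prop) (by fun_prop) (by fun_prop) (by fun_prop) ?_
    rintro r rfl
    simp [h0]⟩
  have hcz : ∀ r ≤ t, c r = z r := fun r hr => if_pos hr
  have hcx : ∀ r, c (t + r) = x r := fun r => by
    rcases le_or_gt r 0 with hr | hr
    · rw [hcz _ (by linarith)]
      have := apply_eq_of_seg_eq (z := x) (w := shift z t) (t := 0)
        (by rw [hzx, seg_shift, add_zero]) hr
      exact this.symm
    · have : ¬ t + r ≤ t := by linarith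
      simp [c, this]
  have hcx' : ∀ r, seg c (t + r) = seg x r := fun r => by
    ext1 s
    rw [seg_apply, seg_apply, add_assoc, hcx]
  refine ⟨c, fun r hr => ?_, seg_congr fun s hs => hcz s (hs.trans ht), fun r _ => hcx' r⟩
  rcases lt_or_ge t r with htr | htr
  · have hxr := hx (r - t) ⟨by linarith, by linarith [hr.2]⟩
    have e : seg c r = seg x (r - t) := by rw [← hcx', add_sub_cancel]
    rw [e]
    refine ⟨hxr.1, ?_⟩
    have hd : HasDerivWithinAt (fun r => x (-t + r)) (f (seg x (r - t))) (Icc t (t + S)) r :=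
      hasDerivWithinAt_comp_const_add (s := Icc 0 S) (by rw [neg_add_eq_sub]; exact hxr.2)
        fun s hs => ⟨by linarith [hs.1], by linarith [hs.2]⟩
    have hcd : (c : ℝ → Fin m → ℝ) = fun r => x (-t + r) := by
      ext1 r
      rw [← hcx]
      simp
    rw [hcd]
    refine hd.mono_of_mem_nhdsWithin ?_
    filter_upwards [self_mem_nhdsWithin, mem_nhdsWithin_of_mem_nhds (Ioi_mem_nhds htr)]
      with s hs hs' using ⟨le_of_lt hs', hs.2⟩
  -- Since $z$ continues beyond $t$, uniqueness makes $c$ agree with $z$ slightly past $t$. This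
  -- gives the derivative at the junction without matching one-sided derivatives.
  · set T' := t + min (T - t) S with hT'
    have htT' : t < T' := by
      have : 0 < min (T - t) S := lt_min (by linarith) hS
      linarith
    have hcz' : ∀ s ≤ T', c s = z s := fun s hs => by
      have := ((hz.shift ht).mono (min_le_left (T - t) S)).eq_of_seg_zero_eq hU hf
        (hx.mono (min_le_right (T - t) S)) (by rw [seg_shift, add_zero, hzx])
        (s := s - t) (by linarith)
      rw [← add_sub_cancel t s, hcx, ← this]
      rfl
    have hT'T : T' ≤ T := by linarith [min_le_left (T - t) S]
    have := ((hz.mono hT'T).congr hcz') r ⟨hr.1, htr.trans htT'.le⟩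
    refine ⟨this.1, this.2.mono_of_mem_nhdsWithin ?_⟩
    filter_upwards [self_mem_nhdsWithin, mem_nhdsWithin_of_mem_nhds
      (Iio_mem_nhds (htr.trans_lt htT'))] with s hs hs' using ⟨hs.1, le_of_lt hs'⟩

theorem flow_add (hU : IsOpen U) (hf : IsC1MB f U) {s t : ℝ} {ψ : History m}
    (ht : (t, ψ) ∈ flowDom U f) (hs : (s, flow U f t ψ) ∈ flowDom U f) :
    (s + t, ψ) ∈ flowDom U f ∧ flow U f s (flow U f t ψ) = flow U f (s + t) ψ := by
  obtain ⟨ht0, T, hT, z, hz, rfl⟩ := mem_flowDom_iff.1 ht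
  obtain ⟨hs0, S, hS, x, hx, hx0⟩ := mem_flowDom_iff.1 hs
  have hT0 : 0 < T := ht0.trans_lt hT
  have hS0 : 0 < S := hs0.trans_lt hS
  rw [flow_eq hU hf hT0 hz hT] at hx0
  obtain ⟨c, hc, hc0, hcx⟩ := exists_isSol_concat hU hf ht0 hT hS0 hz hx hx0
  have hlt : s + t < t + S := by linarith
  refine ⟨mem_flowDom_iff.2 ⟨add_nonneg hs0 ht0, t + S, hlt, c, hc, hc0⟩, ?_⟩
  rw [flow_eq hU hf hT0 hz hT, ← hx0, flow_eq hU hf hS0 hx hS, ← hc0,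
    flow_eq hU hf (by linarith) hc hlt, add_comm s t, hcx s hS.le]

end Semiflow

/-! ### Continuous dependence, and openness of the domain. -/

section ContinuousDependence

variable {m : ℕ} {U : Set (History m)} {f : History m → Fin m → ℝ} {ψ₀ : History m} {S : ℝ}
  {c : C(ℝ, Fin m → ℝ)} {j : ℕ} {δ L ρ : ℝ}

theorem IsFlowBox.mem_tube (h : IsFlowBox U f ψ₀ S c j δ L ρ) (hU : IsOpen U) (hf : IsC1MB f U)
    {z : C(ℝ, Fin m → ℝ)} (hz : IsSol U f S z) (hz0 : nrm j (seg z 0 - ψ₀) < ρ) {t : ℝ}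
    (ht : t ∈ Icc 0 S) : nrm j (seg z t - seg c t) < δ := by
  obtain ⟨w, hw0, hw, hwc⟩ := h.exists_sol _ hz0
  rw [seg_congr fun s hs => hz.eq_of_seg_zero_eq hU hf hw hw0.symm (hs.trans ht.2)]
  exact hwc t ht

/-- The differential inequality involves only `nrm j`, yet every seminorm of the segment is
controlled: the initial window of length $\max(j,k)$ covers both the delay in the inequality and the
past seen by `nrm k`. -/
theorem nrm_seg_le_of_delay_gronwall {d : C(ℝ, Fin m → ℝ)} {d' : ℝ → Fin m → ℝ} {j : ℕ}
    {S L η : ℝ} (hL : 0 ≤ L) (hη : 0 ≤ η)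
    (hd : ∀ t ∈ Icc 0 S, HasDerivWithinAt d (d' t) (Icc 0 S) t)
    (bound : ∀ t ∈ Icc 0 S, ‖d' t‖ ≤ L * nrm j (seg d t) + η) (k : ℕ) {t : ℝ}
    (ht : t ∈ Icc 0 S) :
    nrm k (seg d t) ≤ gronwallConst L S * (nrm (max j k) (seg d 0) + η) := by
  have hG : 1 ≤ gronwallConst L S := one_le_gronwallConst hL (ht.1.trans ht.2)
  have h0 := nrm_nonneg (max j k) (seg d 0)
  have hn : nrm (max j k) (seg d 0) ≤ gronwallConst L S * (nrm (max j k) (seg d 0) + η) :=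
    le_trans (by linarith) (le_mul_of_one_le_left (by positivity) hG)
  refine nrm_seg_le (h0.trans hn) fun s hs hk => ?_
  rcases le_total s 0 with hs0 | hs0
  · exact ((norm_apply_le_nrm_seg d hs0 (by linarith [ht.1])).trans
      (nrm_mono (le_max_right j k) _)).trans hn
  · refine norm_le_of_delay_gronwall hL h0 hη hd bound (fun r hr hr' => ?_) ⟨hs0, hs.trans ht.2⟩
    exact (norm_apply_le_nrm_seg d hr (by linarith)).trans (nrm_mono (le_max_left j k) _)

theorem IsFlowBox.nrm_sub_le (h : IsFlowBox U f ψ₀ S c j δ L ρ) (hU : IsOpen U)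
    (hf : IsC1MB f U) {z w : C(ℝ, Fin m → ℝ)} (hz : IsSol U f S z) (hw : IsSol U f S w)
    (hz0 : nrm j (seg z 0 - ψ₀) < ρ) (hw0 : nrm j (seg w 0 - ψ₀) < ρ) (k : ℕ) {t : ℝ}
    (ht : t ∈ Icc 0 S) :
    nrm k (seg z t - seg w t) ≤ gronwallConst L S * nrm (max j k) (seg z 0 - seg w 0) := by
  have := nrm_seg_le_of_delay_gronwall (d := z - w) (j := j) (η := 0) (S := S) h.lip_nonneg le_rfl
    (fun t ht => (hz t ht).2.sub (hw t ht).2)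
    (fun t ht => by
      rw [add_zero]
      exact (h.tube _ (mem_image_of_mem _ ht) _ _ (h.mem_tube hU hf hz hz0 ht)
        (h.mem_tube hU hf hw hw0 ht)).2) k ht
  rwa [add_zero] at this

theorem exists_isFlowBox_of_mem (hU : IsOpen U) (hf : IsC1MB f U) {t : ℝ} {ψ : History m}
    (h : (t, ψ) ∈ flowDom U f) :
    0 ≤ t ∧ ∃ S > t, ∃ c j δ L ρ, IsFlowBox U f ψ S c j δ L ρ := by
  obtain ⟨h0, T, hT, z, hz, rfl⟩ := mem_flowDom_iff.1 h
  exact ⟨h0, exists_isFlowBox hU hf h0 (hz.mono hT.le)⟩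

theorem IsFlowBox.mem_flowDom (h : IsFlowBox U f ψ₀ S c j δ L ρ) {t : ℝ} (h0 : 0 ≤ t)
    (ht : t < S) {ψ : History m} (hψ : nrm j (ψ - ψ₀) < ρ) : (t, ψ) ∈ flowDom U f := by
  obtain ⟨z, hz0, hz, -⟩ := h.exists_sol ψ hψ
  exact mem_flowDom_iff.2 ⟨h0, S, ht, z, hz, hz0⟩

/-- The open set is the union of all flow boxes, with no sign condition on the time. -/
theorem exists_isOpen_flowDom (hU : IsOpen U) (hf : IsC1MB f U) :
    ∃ O : Set (ℝ × History m), IsOpen O ∧ flowDom U f = O ∩ {p | 0 ≤ p.1} := by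
  refine ⟨{p | ∃ ψ₀ S c j δ L ρ, IsFlowBox U f ψ₀ S c j δ L ρ ∧ p.1 < S ∧
    nrm j (p.2 - ψ₀) < ρ}, isOpen_iff_mem_nhds.2 ?_, ?_⟩
  · rintro p ⟨ψ₀, S, c, j, δ, L, ρ, h, h1, h2⟩
    have hc : Continuous fun p : ℝ × History m => nrm j (p.2 - ψ₀) := by fun_prop
    filter_upwards [(isOpen_lt continuous_fst continuous_const).mem_nhds h1,
      (isOpen_lt hc continuous_const).mem_nhds h2] with q hq1 hq2
      using ⟨ψ₀, S, c, j, δ, L, ρ, h, hq1, hq2⟩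
  · ext ⟨t, ψ⟩
    constructor
    · intro h
      obtain ⟨h0, S, hS, c, j, δ, L, ρ, hbox⟩ := exists_isFlowBox_of_mem hU hf h
      exact ⟨⟨ψ, S, c, j, δ, L, ρ, hbox, hS, by simpa using hbox.pos_radius⟩, h0⟩
    · rintro ⟨⟨ψ₀, S, c, j, δ, L, ρ, h, h1, h2⟩, h0⟩
      exact h.mem_flowDom h0 h1 h2

theorem isOpen_flowDom_section (hU : IsOpen U) (hf : IsC1MB f U) {t : ℝ} (ht : 0 ≤ t) :
    IsOpen {ψ | (t, ψ) ∈ flowDom U f} := by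
  obtain ⟨O, hO, h⟩ := exists_isOpen_flowDom hU hf
  have : {ψ | (t, ψ) ∈ flowDom U f} = (fun ψ => (t, ψ)) ⁻¹' O := by
    ext ψ
    simp [h, ht]
  rw [this]
  exact hO.preimage (by fun_prop)

theorem continuousOn_flow (hU : IsOpen U) (hf : IsC1MB f U) :
    ContinuousOn (fun p : ℝ × History m => flow U f p.1 p.2) (flowDom U f) := by
  rintro ⟨t₀, ψ₀⟩ h
  obtain ⟨h0, S, hS, c, j, δ, L, ρ, hbox⟩ := exists_isFlowBox_of_mem hU hf h
  have hS0 : 0 < S := h0.trans_lt hS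
  have hψ₀ : nrm j (ψ₀ - ψ₀) < ρ := by simpa using hbox.pos_radius
  obtain ⟨w, hw0, hw, -⟩ := hbox.exists_sol ψ₀ hψ₀
  refine tendsto_iff_nrm.2 fun k r hr => ?_
  have hG := one_le_gronwallConst hbox.lip_nonneg hS0.le
  set G := gronwallConst L S
  have e1 : ∀ᶠ p : ℝ × History m in 𝓝 (t₀, ψ₀), p.1 < S :=
    continuous_fst.continuousAt.eventually_lt continuousAt_const hS
  have e2 : ∀ i : ℕ, ∀ r > 0, ∀ᶠ p : ℝ × History m in 𝓝 (t₀, ψ₀), nrm i (p.2 - ψ₀) < r :=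
    fun i r hr => by
    have hs : Tendsto Prod.snd (𝓝 (t₀, ψ₀)) (𝓝 ψ₀) := continuous_snd.tendsto _
    exact hs.eventually (eventually_nrm_sub_lt i ψ₀ hr)
  have e3 : ∀ᶠ p : ℝ × History m in 𝓝 (t₀, ψ₀), nrm k (seg w p.1 - seg w t₀) < r / 2 :=
    (((continuous_seg w).comp continuous_fst).tendsto (t₀, ψ₀)).eventually
      (eventually_nrm_sub_lt k (seg w t₀) (half_pos hr))
  filter_upwards [self_mem_nhdsWithin, nhdsWithin_le_nhds e1,
    nhdsWithin_le_nhds (e2 j ρ hbox.pos_radius),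
    nhdsWithin_le_nhds (e2 (max j k) (r / 2 / G) (by positivity)),
    nhdsWithin_le_nhds e3] with p hp hp1 hp2 hp3 hp4
  obtain ⟨z, hz0, hz, -⟩ := hbox.exists_sol p.2 hp2
  have hb := hbox.nrm_sub_le hU hf hz hw (by rwa [hz0]) (by rwa [hw0]) k ⟨hp.1, hp1.le⟩
  rw [← hz0, flow_eq hU hf hS0 hz hp1, ← hw0, flow_eq hU hf hS0 hw hS]
  rw [hz0, hw0] at hb
  rw [lt_div_iff₀ (by positivity)] at hp3
  linarith [DelayEquation.nrm_sub_le k (seg z p.1) (seg w p.1) (seg w t₀)]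

end ContinuousDependence

end DelayEquation

namespace DelayEquation

/-! ### The variational equation and the directional derivatives of the flow. -/

section VariationalEquation

variable {m : ℕ} {U : Set (History m)} {f : History m → Fin m → ℝ} {ψ₀ : History m} {S : ℝ}
  {c : C(ℝ, Fin m → ℝ)} {j : ℕ} {δ L ρ : ℝ} {Df : History m → History m → Fin m → ℝ}

/-- `w` is a solution of the linear variational equation `w'(s) = Df(z_s) w_s` on `[0, S]`. -/
def IsVarSol (Df : History m → History m → Fin m → ℝ) (z : C(ℝ, Fin m → ℝ)) (S : ℝ)
    (w : C(ℝ, Fin m → ℝ)) : Prop :=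
  ∀ s ∈ Icc 0 S, HasDerivWithinAt w (Df (seg z s) (seg w s)) (Icc 0 S) s

theorem IsVarSol.mono {z w : C(ℝ, Fin m → ℝ)} {S' : ℝ} (h : IsVarSol Df z S w) (hS : S' ≤ S) :
    IsVarSol Df z S' w :=
  fun s hs => (h s ⟨hs.1, hs.2.trans hS⟩).mono (Icc_subset_Icc_right hS)

theorem IsFlowBox.mono (h : IsFlowBox U f ψ₀ S c j δ L ρ) {S' : ℝ} (hS : S' ≤ S) :
    IsFlowBox U f ψ₀ S' c j δ L ρ where
  pos_radius := h.pos_radius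
  lip_nonneg := h.lip_nonneg
  tube := h.tube.mono (image_mono (Icc_subset_Icc_right hS)) le_rfl le_rfl h.lip_nonneg le_rfl
  exists_sol ψ hψ := by
    obtain ⟨z, hz0, hz, hzc⟩ := h.exists_sol ψ hψ
    exact ⟨z, hz0, hz.mono hS, fun t ht => hzc t ⟨ht.1, ht.2.trans hS⟩⟩

/-- The Lipschitz bound of $f$ passes to difference quotients in two directions with the same step,
hence to the limit. Linearity of the derivative is not used. -/
theorem IsTube.norm_dirDeriv_sub_le {K : Set (History m)} (h : IsTube U f K j δ L)
    {κ χ v v' : History m} (hκ : κ ∈ K) (hχ : nrm j (χ - κ) < δ) {a a' : Fin m → ℝ}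
    (ha : HasDirDeriv f χ v a) (ha' : HasDirDeriv f χ v' a') :
    ‖a - a'‖ ≤ L * nrm j (v - v') := by
  have hev : ∀ v : History m, ∀ᶠ x : ℝ in 𝓝 0, nrm j (χ + x • v - κ) < δ := fun v => by
    have hc : Continuous fun x : ℝ => nrm j (χ + x • v - κ) := by fun_prop
    exact hc.continuousAt.eventually_lt continuousAt_const (by simpa using hχ)
  refine ha.norm_sub_le ha' ?_
  filter_upwards [hev v, hev v'] with x hx hx'
  refine (h κ hκ _ _ hx hx').2.trans_eq ?_
  rw [add_sub_add_left_eq_sub, ← smul_sub, nrm_smul]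
  ring

theorem IsFlowBox.norm_dirDeriv_sub_le (h : IsFlowBox U f ψ₀ S c j δ L ρ) (hU : IsOpen U)
    (hf : IsC1MB f U) (hD : ∀ u ∈ U, ∀ v, HasDirDeriv f u v (Df u v)) {z : C(ℝ, Fin m → ℝ)}
    (hz : IsSol U f S z) (hz0 : nrm j (seg z 0 - ψ₀) < ρ) {s : ℝ} (hs : s ∈ Icc 0 S)
    (v v' : History m) : ‖Df (seg z s) v - Df (seg z s) v'‖ ≤ L * nrm j (v - v') :=
  h.tube.norm_dirDeriv_sub_le (mem_image_of_mem _ hs) (h.mem_tube hU hf hz hz0 hs)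
    (hD _ (hz s hs).1 v) (hD _ (hz s hs).1 v')

theorem IsFlowBox.exists_isVarSol (h : IsFlowBox U f ψ₀ S c j δ L ρ) (hS : 0 ≤ S)
    (hU : IsOpen U) (hf : IsC1MB f U) (hD : ∀ u ∈ U, ∀ v, HasDirDeriv f u v (Df u v))
    (hDc : ContinuousOn (fun p : History m × History m => Df p.1 p.2) (U ×ˢ univ))
    {z : C(ℝ, Fin m → ℝ)} (hz : IsSol U f S z) (hz0 : nrm j (seg z 0 - ψ₀) < ρ)
    (v : History m) : ∃ w, seg w 0 = v ∧ IsVarSol Df z S w :=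
  exists_solution_of_lipschitz hS h.lip_nonneg (fun s χ => Df (seg z s) χ)
    (fun w => hDc.comp (f := fun s => (seg z s, seg w s)) (Continuous.continuousOn (by fun_prop))
      fun s hs => ⟨(hz s hs).1, mem_univ _⟩)
    (fun _ hs => h.norm_dirDeriv_sub_le hU hf hD hz hz0 hs) v

/-- In $Df(z_s)w_s-Df(z^0_s)w^0_s$ the mixed term $Df(z_s)w^0_s$ is inserted. The first difference
is Lipschitz in $w-w^0$; the second is the inhomogeneity $\eta$, needed only along the fixed
solution $w^0$. -/
theorem IsFlowBox.nrm_varSol_sub_le (h : IsFlowBox U f ψ₀ S c j δ L ρ) (hU : IsOpen U)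
    (hf : IsC1MB f U) (hD : ∀ u ∈ U, ∀ v, HasDirDeriv f u v (Df u v))
    {z z₀ w w₀ : C(ℝ, Fin m → ℝ)} (hz : IsSol U f S z) (hz0 : nrm j (seg z 0 - ψ₀) < ρ)
    (hw : IsVarSol Df z S w) (hw₀ : IsVarSol Df z₀ S w₀) {η : ℝ} (hη : 0 ≤ η)
    (hb : ∀ s ∈ Icc 0 S, ‖Df (seg z s) (seg w₀ s) - Df (seg z₀ s) (seg w₀ s)‖ ≤ η) (k : ℕ)
    {t : ℝ} (ht : t ∈ Icc 0 S) :
    nrm k (seg w t - seg w₀ t) ≤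
      gronwallConst L S * (nrm (max j k) (seg w 0 - seg w₀ 0) + η) :=
  nrm_seg_le_of_delay_gronwall (d := w - w₀) (j := j) h.lip_nonneg hη
    (fun s hs => (hw s hs).sub (hw₀ s hs))
    (fun s hs => by
      have h1 := h.norm_dirDeriv_sub_le hU hf hD hz hz0 hs (seg w s) (seg w₀ s)
      have h2 := norm_add_le (Df (seg z s) (seg w s) - Df (seg z s) (seg w₀ s))
        (Df (seg z s) (seg w₀ s) - Df (seg z₀ s) (seg w₀ s))
      rw [sub_add_sub_cancel] at h2
      rw [seg_sub]
      linarith [hb s hs]) k ht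

/-- Mean value inequality for $\theta\mapsto f(z_s+\theta w_s)-\theta Df(z_s)w_s$, whose derivative
is small near $\theta=0$ by continuity of $Df$, uniformly in $s$ since $[0,S]$ is compact. -/
theorem eventually_norm_remainder_le (hU : IsOpen U)
    (hD : ∀ u ∈ U, ∀ v, HasDirDeriv f u v (Df u v))
    (hDc : ContinuousOn (fun p : History m × History m => Df p.1 p.2) (U ×ˢ univ))
    {z w : C(ℝ, Fin m → ℝ)} (hz : ∀ s ∈ Icc 0 S, seg z s ∈ U) {η : ℝ} (hη : 0 < η) :
    ∀ᶠ h : ℝ in 𝓝 0, ∀ s ∈ Icc 0 S,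
      ‖f (seg z s + h • seg w s) - f (seg z s) - h • Df (seg z s) (seg w s)‖ ≤ η * |h| := by
  have hev : ∀ᶠ h : ℝ in 𝓝 0, ∀ s ∈ Icc 0 S, seg z s + h • seg w s ∈ U ∧
      ‖Df (seg z s + h • seg w s) (seg w s) - Df (seg z s) (seg w s)‖ < η := by
    refine isCompact_Icc.eventually_forall_of_forall_eventually fun s hs => ?_
    have hc1 : Continuous fun p : ℝ × ℝ => seg z p.2 + p.1 • seg w p.2 := by fun_prop
    have hc2 : Continuous fun p : ℝ × ℝ => seg w p.2 := by fun_prop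
    have hc3 : Continuous fun p : ℝ × ℝ => seg z p.2 := by fun_prop
    have hDat : ∀ v, ContinuousAt (fun p : History m × History m => Df p.1 p.2) (seg z s, v) :=
      fun v => hDc.continuousAt (prod_mem_nhds (hU.mem_nhds (hz s hs)) univ_mem)
    have e1 : ∀ᶠ p : ℝ × ℝ in 𝓝 (0, s), seg z p.2 + p.1 • seg w p.2 ∈ U :=
      hc1.continuousAt.eventually_mem (hU.mem_nhds (by simpa using hz s hs))
    have e2 : ContinuousAt (fun p : ℝ × ℝ =>
        Df (seg z p.2 + p.1 • seg w p.2) (seg w p.2)) (0, s) :=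
      ContinuousAt.comp (f := fun p : ℝ × ℝ => (seg z p.2 + p.1 • seg w p.2, seg w p.2))
        (g := fun p : History m × History m => Df p.1 p.2)
        (by simpa using hDat (seg w s)) (hc1.prodMk hc2).continuousAt
    have e3 : ContinuousAt (fun p : ℝ × ℝ => Df (seg z p.2) (seg w p.2)) (0, s) :=
      ContinuousAt.comp (f := fun p : ℝ × ℝ => (seg z p.2, seg w p.2))
        (g := fun p : History m × History m => Df p.1 p.2) (hDat (seg w s))
        (hc3.prodMk hc2).continuousAt
    have e4 := (e2.sub e3).norm.eventually_lt (continuousAt_const (y := η)) (by simpa using hη)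
    filter_upwards [e1, e4] with p hp1 hp2 using ⟨hp1, hp2⟩
  obtain ⟨r, hr, hball⟩ := Metric.eventually_nhds_iff_ball.1 hev
  filter_upwards [Metric.ball_mem_nhds 0 hr] with x hx s hs
  have := (convex_ball (0 : ℝ) r).norm_image_sub_le_of_norm_hasDerivWithin_le
    (f := fun θ : ℝ => f (seg z s + θ • seg w s) - θ • Df (seg z s) (seg w s)) (C := η)
    (fun θ hθ => ((hD _ (hball θ hθ s hs).1 (seg w s)).hasDerivAt.sub
      ((hasDerivAt_id θ).smul_const (Df (seg z s) (seg w s)))).hasDerivWithinAt)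
    (fun θ hθ => by simpa using (hball θ hθ s hs).2.le) (Metric.mem_ball_self hr) hx
  simpa [sub_right_comm] using this

/-- With $y$ the solution starting at $\psi_0+xv$, $v=w_0$, the error $d=x^{-1}(y-z)-w$ has $d_0=0$.
Splitting its derivative at $f(z_s+xw_s)$ leaves a term Lipschitz in $d_s$ and a Taylor remainder of
size $\eta$, so Gronwall bounds $d_t$ by a multiple of $\eta$. -/
theorem IsFlowBox.hasDirDeriv_flow (h : IsFlowBox U f ψ₀ S c j δ L ρ) (hU : IsOpen U)
    (hf : IsC1MB f U) (hD : ∀ u ∈ U, ∀ v, HasDirDeriv f u v (Df u v))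
    (hDc : ContinuousOn (fun p : History m × History m => Df p.1 p.2) (U ×ˢ univ))
    {z w : C(ℝ, Fin m → ℝ)} (hz : IsSol U f S z) (hz0 : seg z 0 = ψ₀)
    (hw : IsVarSol Df z S w) {t : ℝ} (ht0 : 0 ≤ t) (ht : t < S) :
    HasDirDeriv (flow U f t) ψ₀ (seg w 0) (seg w t) := by
  have hS0 : 0 < S := ht0.trans_lt ht
  have hz0' : nrm j (seg z 0 - ψ₀) < ρ := by simpa [hz0] using h.pos_radius
  refine tendsto_iff_nrm.2 fun k r hr => ?_
  have hG := one_le_gronwallConst h.lip_nonneg hS0.le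
  set G := gronwallConst L S
  have hη : 0 < r / 2 / G := by positivity
  have e1 : ∀ᶠ x : ℝ in 𝓝 0, nrm j (ψ₀ + x • seg w 0 - ψ₀) < ρ := by
    have hc : Continuous fun x : ℝ => nrm j (ψ₀ + x • seg w 0 - ψ₀) := by fun_prop
    exact hc.continuousAt.eventually_lt continuousAt_const (by simpa using h.pos_radius)
  have e2 : ∀ᶠ x : ℝ in 𝓝 0, ∀ s ∈ Icc 0 S, nrm j (seg z s + x • seg w s - seg c s) < δ := by
    refine isCompact_Icc.eventually_forall_of_forall_eventually fun s hs => ?_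
    have hc : Continuous fun p : ℝ × ℝ => nrm j (seg z p.2 + p.1 • seg w p.2 - seg c p.2) := by
      fun_prop
    exact hc.continuousAt.eventually_lt continuousAt_const
      (by simpa using h.mem_tube hU hf hz hz0' hs)
  have e3 := eventually_norm_remainder_le hU hD hDc (w := w) (fun s hs => (hz s hs).1) hη
  filter_upwards [self_mem_nhdsWithin, nhdsWithin_le_nhds e1, nhdsWithin_le_nhds e2,
    nhdsWithin_le_nhds e3] with x hx hx1 hx2 hx3
  have hx : x ≠ 0 := hx
  obtain ⟨y, hy0, hy, -⟩ := h.exists_sol _ hx1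
  have hy0' : nrm j (seg y 0 - ψ₀) < ρ := by rwa [hy0]
  have hseg : ∀ s, seg (x⁻¹ • (y - z) - w) s =
      x⁻¹ • (seg y s - (seg z s + x • seg w s)) := fun s => by
    rw [seg_sub, seg_smul, seg_sub, ← sub_sub, smul_sub _ _ (x • seg w s), smul_smul,
      inv_mul_cancel₀ hx, one_smul]
  have hest := nrm_seg_le_of_delay_gronwall (d := x⁻¹ • (y - z) - w) (j := j) h.lip_nonneg hη.le
    (fun s hs => (((hy s hs).2.sub (hz s hs).2).const_smul x⁻¹).sub (hw s hs))
    (fun s hs => by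
      have h1 := (h.tube _ (mem_image_of_mem _ hs) _ _ (h.mem_tube hU hf hy hy0' hs)
        (hx2 s hs)).2
      have h2 := hx3 s hs
      have h3 : x⁻¹ • (f (seg y s) - f (seg z s)) - Df (seg z s) (seg w s) =
          x⁻¹ • (f (seg y s) - f (seg z s + x • seg w s)) + x⁻¹ •
          (f (seg z s + x • seg w s) - f (seg z s) - x • Df (seg z s) (seg w s)) := by
        simp only [smul_sub, smul_smul, inv_mul_cancel₀ hx, one_smul]
        abel
      rw [hseg, nrm_smul, h3]
      refine (norm_add_le _ _).trans (add_le_add ?_ ?_)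
      · rw [norm_smul, Real.norm_eq_abs, mul_left_comm]
        exact mul_le_mul_of_nonneg_left h1 (abs_nonneg _)
      · rw [norm_smul, Real.norm_eq_abs, abs_inv, inv_mul_le_iff₀ (abs_pos.2 hx), mul_comm |x|]
        exact h2) k ⟨ht0, ht.le⟩
  have hd0 : seg (x⁻¹ • (y - z) - w) 0 = 0 := by
    rw [hseg, hy0, hz0, sub_self, smul_zero]
  rw [hd0, nrm_zero, zero_add] at hest
  have hfin : x⁻¹ • (flow U f t (ψ₀ + x • seg w 0) - flow U f t ψ₀) - seg w t =
      seg (x⁻¹ • (y - z) - w) t := by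
    rw [← hy0, ← hz0, flow_eq hU hf hS0 hy ht, flow_eq hU hf hS0 hz ht]
    rfl
  rw [hfin]
  refine hest.trans_lt ?_
  rw [mul_div_cancel₀ _ (by positivity)]
  linarith

theorem exists_isVarSol_hasDirDeriv_flow (hU : IsOpen U) (hf : IsC1MB f U)
    (hD : ∀ u ∈ U, ∀ v, HasDirDeriv f u v (Df u v))
    (hDc : ContinuousOn (fun p : History m × History m => Df p.1 p.2) (U ×ˢ univ))
    {t : ℝ} {ψ : History m} (h : (t, ψ) ∈ flowDom U f) :
    ∃ z, IsSol U f t z ∧ seg z 0 = ψ ∧ ∀ v, ∃ w, seg w 0 = v ∧ IsVarSol Df z t w ∧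
      HasDirDeriv (flow U f t) ψ v (seg w t) := by
  obtain ⟨ht0, S, hS, c, j, δ, L, ρ, hbox⟩ := exists_isFlowBox_of_mem hU hf h
  obtain ⟨z, hz0, hz, -⟩ := hbox.exists_sol ψ (by simpa using hbox.pos_radius)
  refine ⟨z, hz.mono hS.le, hz0, fun v => ?_⟩
  obtain ⟨w, rfl, hw⟩ := hbox.exists_isVarSol (ht0.trans hS.le) hU hf hD hDc hz
    (by simpa [hz0] using hbox.pos_radius) v
  exact ⟨w, rfl, hw.mono hS.le, hbox.hasDirDeriv_flow hU hf hD hDc hz hz0 hw ht0 hS⟩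

/-- Solutions starting near `ψ₀` stay uniformly near the solution starting at `ψ₀`. -/
theorem IsFlowBox.eventually_forall_seg_sub (h : IsFlowBox U f ψ₀ S c j δ L ρ) (hS : 0 ≤ S)
    (hU : IsOpen U) (hf : IsC1MB f U) {z₀ : C(ℝ, Fin m → ℝ)} (hz₀ : IsSol U f S z₀)
    (hz₀0 : seg z₀ 0 = ψ₀) {P : History m → Prop} (hP : ∀ᶠ ξ in 𝓝 0, P ξ) :
    ∀ᶠ ψ in 𝓝 ψ₀, ∀ z, IsSol U f S z → seg z 0 = ψ → ∀ s ∈ Icc 0 S, P (seg z s - seg z₀ s) := by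
  obtain ⟨⟨k, r⟩, hr, hkr⟩ := (nhds_basis_nrm 0).eventually_iff.1 hP
  have hG := one_le_gronwallConst h.lip_nonneg hS
  set G := gronwallConst L S
  filter_upwards [eventually_nrm_sub_lt j ψ₀ h.pos_radius,
    eventually_nrm_sub_lt (max j k) ψ₀ (div_pos hr (zero_lt_one.trans_le hG))]
    with ψ h1 h2 z hz hz0 s hs
  refine hkr ?_
  have := h.nrm_sub_le hU hf hz hz₀ (by rwa [hz0])
    (by simpa [hz₀0] using h.pos_radius) k hs
  rw [hz0, hz₀0] at this
  rw [lt_div_iff₀ (by positivity), mul_comm] at h2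
  simpa using this.trans_lt h2

end VariationalEquation

/-! ### Smoothness of the solution operators in both senses. -/

section Smoothness

variable {m : ℕ} {U : Set (History m)} {f : History m → Fin m → ℝ}

/-- The solution operators of a `C¹_MB`-smooth equation are `C¹_MB`-smooth. -/
theorem isC1MB_flow (hU : IsOpen U) (hf : IsC1MB f U) (t : ℝ) :
    IsC1MB (flow U f t) {ψ | (t, ψ) ∈ flowDom U f} := by
  obtain ⟨-, Df, hD, hDc⟩ := id hf
  have hex : ∀ ψ, (t, ψ) ∈ flowDom U f → _ := fun ψ h =>
    exists_isVarSol_hasDirDeriv_flow hU hf hD hDc h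
  choose! z hz hz0 w hw0 hw hwD using hex
  refine ⟨(continuousOn_flow hU hf).comp (f := fun ψ => (t, ψ))
    (Continuous.continuousOn (by fun_prop)) fun ψ hψ => hψ, fun ψ v => seg (w ψ v) t, hwD, ?_⟩
  rintro ⟨ψ₀, v₀⟩ ⟨h₀, -⟩
  have h₀ : (t, ψ₀) ∈ flowDom U f := h₀
  obtain ⟨ht0, S, hS, c, j, δ, L, ρ, hbox⟩ := exists_isFlowBox_of_mem hU hf h₀
  replace hbox := hbox.mono hS.le
  have hG := one_le_gronwallConst hbox.lip_nonneg ht0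
  refine tendsto_iff_nrm.2 fun k r hr => ?_
  set G := gronwallConst L t
  have hη : 0 < r / 4 / G := by positivity
  -- The coefficient is perturbed by one $\xi$ for all $s$, along the fixed solution
  -- $w^{\psi_0,v_0}$. Continuous dependence later supplies $\xi=z_s-z^0_s$.
  have e1 : ∀ᶠ ξ : History m in 𝓝 0, ∀ s ∈ Icc 0 t,
      ‖Df (seg (z ψ₀) s + ξ) (seg (w ψ₀ v₀) s) - Df (seg (z ψ₀) s) (seg (w ψ₀ v₀) s)‖ <
        r / 4 / G := by
    refine isCompact_Icc.eventually_forall_of_forall_eventually fun s hs => ?_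
    have hDat : ContinuousAt (fun p : History m × History m => Df p.1 p.2)
        (seg (z ψ₀) s, seg (w ψ₀ v₀) s) :=
      hDc.continuousAt (prod_mem_nhds (hU.mem_nhds (hz ψ₀ h₀ s hs).1) univ_mem)
    have e2 : ContinuousAt (fun p : History m × ℝ =>
        Df (seg (z ψ₀) p.2 + p.1) (seg (w ψ₀ v₀) p.2)) (0, s) :=
      ContinuousAt.comp
        (f := fun p : History m × ℝ => (seg (z ψ₀) p.2 + p.1, seg (w ψ₀ v₀) p.2))
        (g := fun p : History m × History m => Df p.1 p.2) (by simpa using hDat)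
        (Continuous.continuousAt (by fun_prop))
    have e3 : ContinuousAt (fun p : History m × ℝ =>
        Df (seg (z ψ₀) p.2) (seg (w ψ₀ v₀) p.2)) (0, s) :=
      ContinuousAt.comp (f := fun p : History m × ℝ => (seg (z ψ₀) p.2, seg (w ψ₀ v₀) p.2))
        (g := fun p : History m × History m => Df p.1 p.2) hDat
        (Continuous.continuousAt (by fun_prop))
    exact (e2.sub e3).norm.eventually_lt continuousAt_const (by simpa using hη)
  have e2 := hbox.eventually_forall_seg_sub ht0 hU hf (hz ψ₀ h₀) (hz0 ψ₀ h₀) e1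
  have hfst : Tendsto Prod.fst (𝓝 (ψ₀, v₀)) (𝓝 ψ₀) := continuous_fst.tendsto _
  have hsnd : Tendsto Prod.snd (𝓝 (ψ₀, v₀)) (𝓝 v₀) := continuous_snd.tendsto _
  filter_upwards [self_mem_nhdsWithin, nhdsWithin_le_nhds (hfst.eventually e2),
    nhdsWithin_le_nhds (hfst.eventually (eventually_nrm_sub_lt j ψ₀ hbox.pos_radius)),
    nhdsWithin_le_nhds (hsnd.eventually (eventually_nrm_sub_lt (max j k) v₀ hη))]
    with p hp hp1 hp2 hp3
  have hb := hbox.nrm_varSol_sub_le hU hf hD (hz p.1 hp.1)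
    (by rwa [hz0 p.1 hp.1]) (hw p.1 hp.1 p.2) (hw ψ₀ h₀ v₀) hη.le
    (fun s hs => by
      have := (hp1 (z p.1) (hz p.1 hp.1) (hz0 p.1 hp.1) s hs s hs).le
      rwa [add_sub_cancel] at this) k ⟨ht0, le_rfl⟩
  rw [hw0 p.1 hp.1, hw0 ψ₀ h₀] at hb
  refine hb.trans_lt ?_
  have : G * (nrm (max j k) (p.2 - v₀) + r / 4 / G) < G * (r / 4 / G + r / 4 / G) := by
    gcongr
  refine this.trans ?_
  rw [← two_mul, mul_left_comm, mul_div_cancel₀ _ (by positivity)]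
  linarith

theorem exists_nrm_le_of_isVonNBounded {B : Set (History m)} (hB : Bornology.IsVonNBounded ℝ B)
    (k : ℕ) : ∃ C, ∀ v ∈ B, nrm k v ≤ C := by
  have hV : {v : History m | nrm k v < 1} ∈ 𝓝 0 :=
    (isOpen_lt (continuous_nrm k) continuous_const).mem_nhds (by simp)
  obtain ⟨a, ha⟩ := (hB hV).exists_pos
  obtain ⟨ha0, ha⟩ := ha
  refine ⟨a, fun v hv => ?_⟩
  obtain ⟨u, hu, rfl⟩ := ha a (by simp [abs_of_pos ha0]) hv
  have hu : nrm k u < 1 := hu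
  simp only [nrm_smul, abs_of_pos ha0]
  nlinarith

theorem isVonNBounded_of_forall_nrm_le {B : Set (History m)}
    (h : ∀ k, ∃ C, ∀ v ∈ B, nrm k v ≤ C) : Bornology.IsVonNBounded ℝ B := by
  refine (nhds_basis_nrm (0 : History m)).isVonNBounded_iff.2 ?_
  rintro ⟨k, r⟩ hr
  have hr : 0 < r := hr
  obtain ⟨C, hC⟩ := h k
  refine Absorbs.of_norm ⟨(|C| + 1) / r, fun a ha v hv => ?_⟩
  have ha0 : 0 < |a| := lt_of_lt_of_le (by positivity) ha
  refine ⟨a⁻¹ • v, ?_, ?_⟩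
  · simp only [sub_zero, mem_ofPred_eq, nrm_smul, abs_inv]
    rw [inv_mul_lt_iff₀ ha0]
    have h1 := hC v hv
    have h2 := le_abs_self C
    rw [Real.norm_eq_abs, div_le_iff₀ hr] at ha
    linarith
  · exact smul_inv_smul₀ (abs_pos.1 ha0) v

theorem eq_of_forall_nrm_sub_le_zero {ψ χ : History m} (h : ∀ k, nrm k (ψ - χ) ≤ 0) : ψ = χ := by
  ext1 s
  obtain ⟨k, hk⟩ := exists_nat_gt (-(s : ℝ))
  have := (norm_apply_le_nrm (k := k) (ψ - χ) (s := s) (by linarith)).trans (h k)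
  simpa [sub_eq_zero] using this

/-- When each $Df(u)$ is linear, sums and multiples of variational solutions are variational
solutions. Uniqueness makes $v\mapsto w_t$ linear, and the Gronwall estimate makes it continuous. -/
theorem exists_clm_hasDirDeriv_flow (hU : IsOpen U) (hf : IsC1MB f U)
    {Df : History m → History m →L[ℝ] Fin m → ℝ}
    (hD : ∀ u ∈ U, ∀ v, HasDirDeriv f u v (Df u v))
    (hDc : ContinuousOn (fun p : History m × History m => Df p.1 p.2) (U ×ˢ univ))
    {t : ℝ} {ψ : History m} (h : (t, ψ) ∈ flowDom U f) :
    ∃ z, IsSol U f t z ∧ seg z 0 = ψ ∧ ∃ A : History m →L[ℝ] History m, ∀ v, ∃ w,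
      seg w 0 = v ∧ IsVarSol (fun u v => Df u v) z t w ∧ HasDirDeriv (flow U f t) ψ v (A v) ∧
      A v = seg w t := by
  obtain ⟨ht0, S, hS, c, j, δ, L, ρ, hbox⟩ := exists_isFlowBox_of_mem hU hf h
  replace hbox := hbox.mono hS.le
  obtain ⟨z, hz, hz0, hex⟩ :=
    exists_isVarSol_hasDirDeriv_flow (Df := fun u v => Df u v) hU hf hD hDc h
  choose w hw0 hw hwD using hex
  have hG := one_le_gronwallConst hbox.lip_nonneg ht0
  have hest : ∀ {x y}, IsVarSol (fun u v => Df u v) z t x → IsVarSol (fun u v => Df u v) z t y →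
      ∀ k, nrm k (seg x t - seg y t) ≤
        gronwallConst L t * nrm (max j k) (seg x 0 - seg y 0) := fun hx hy k => by
    simpa using hbox.nrm_varSol_sub_le hU hf hD hz (by simpa [hz0] using hbox.pos_radius) hx hy
      le_rfl (fun s hs => by simp) k ⟨ht0, le_rfl⟩
  have huniq : ∀ {x y}, IsVarSol (fun u v => Df u v) z t x → IsVarSol (fun u v => Df u v) z t y →
      seg x 0 = seg y 0 → seg x t = seg y t := fun hx hy h0 =>
    eq_of_forall_nrm_sub_le_zero fun k => by simpa [h0] using hest hx hy k
  let A : History m →L[ℝ] History m :=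
    { toFun := fun v => seg (w v) t
      map_add' := fun u v => by
        have hs : IsVarSol (fun u v => Df u v) z t (w u + w v) := fun s hs => by
          have := (hw u s hs).add (hw v s hs)
          rwa [← map_add, ← seg_add] at this
        rw [← seg_add]
        exact huniq (hw _) hs (by rw [seg_add, hw0, hw0, hw0])
      map_smul' := fun a v => by
        have hs : IsVarSol (fun u v => Df u v) z t (a • w v) := fun s hs => by
          have := (hw v s hs).const_smul a
          rwa [← map_smul, ← seg_smul] at this
        rw [RingHom.id_apply, ← seg_smul]
        exact huniq (hw _) hs (by rw [seg_smul, hw0, hw0])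
      cont := continuous_iff_continuousAt.2 fun v₀ => tendsto_iff_nrm.2 fun k r hr => by
        filter_upwards [eventually_nrm_sub_lt (max j k) v₀
          (div_pos hr (zero_lt_one.trans_le hG))] with v hv
        rw [lt_div_iff₀ (by positivity), mul_comm] at hv
        have := hest (hw v) (hw v₀) k
        rw [hw0, hw0] at this
        exact this.trans_lt hv }
  exact ⟨z, hz, hz0, A, fun v => ⟨w v, hw0 v, hw v, hwD v, rfl⟩⟩

instance : FirstCountableTopology (History m) := by
  have : LocallyCompactSpace (Iic (0 : ℝ)) :=
    isClosed_Iic.isClosedEmbedding_subtypeVal.locallyCompactSpace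
  have : SigmaCompactSpace (Iic (0 : ℝ)) :=
    isClosed_Iic.isClosedEmbedding_subtypeVal.sigmaCompactSpace
  exact UniformSpace.firstCountableTopology _

/-- The solution operators of a `C¹_F`-smooth equation are `C¹_F`-smooth. -/
theorem isC1F_flow (hU : IsOpen U) (hf : IsC1F f U) (t : ℝ) :
    IsC1F (flow U f t) {ψ | (t, ψ) ∈ flowDom U f} := by
  have hMB := hf.isC1MB
  obtain ⟨-, Df, hD, hDc⟩ := id hf
  have hDc' : ContinuousOn (fun p : History m × History m => Df p.1 p.2) (U ×ˢ univ) := by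
    obtain ⟨-, Df', hD', hDc'⟩ := id hMB
    exact hDc'.congr fun p hp => (hD p.1 hp.1 p.2).unique (hD' p.1 hp.1 p.2)
  have hex : ∀ ψ, (t, ψ) ∈ flowDom U f → _ := fun ψ h =>
    exists_clm_hasDirDeriv_flow hU hMB hD hDc' h
  choose! z hz hz0 A w hw0 hw hwD hAw using hex
  refine ⟨(isC1MB_flow hU hMB t).1, A, hwD, fun ψ₀ h₀ => ?_⟩
  have h₀ : (t, ψ₀) ∈ flowDom U f := h₀
  obtain ⟨ht0, S, hS, c, j, δ, L, ρ, hbox⟩ := exists_isFlowBox_of_mem hU hMB h₀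
  replace hbox := hbox.mono hS.le
  have hz₀ : nrm j (seg (z ψ₀) 0 - ψ₀) < ρ := by simpa [hz0 ψ₀ h₀] using hbox.pos_radius
  have hG := one_le_gronwallConst hbox.lip_nonneg ht0
  set G := gronwallConst L t
  rw [ContinuousWithinAt, tendsto_sub_nhds_zero_iff.symm]
  refine (ContinuousLinearMap.hasBasis_nhds_zero_of_basis
    (nhds_basis_nrm (0 : History m))).tendsto_right_iff.2 ?_
  rintro ⟨B, k, r⟩ ⟨hB, hr⟩
  have hr : 0 < r := hr
  have hη : 0 < r / 2 / G := by positivity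
  -- All segments of variational solutions starting in $B$ form a bounded set, by Gronwall against
  -- the zero solution. Closeness of the derivatives of $f$ uniformly on this set makes $\eta$
  -- independent of $v\in B$.
  set B' : Set (History m) := {u | ∃ v ∈ B, ∃ s ∈ Icc 0 t, u = seg (w ψ₀ v) s}
  have hB' : Bornology.IsVonNBounded ℝ B' := isVonNBounded_of_forall_nrm_le fun k => by
    obtain ⟨C, hC⟩ := exists_nrm_le_of_isVonNBounded hB (max j k)
    refine ⟨G * C, ?_⟩
    rintro _ ⟨v, hv, s, hs, rfl⟩
    have h0 : IsVarSol (fun u v => Df u v) (z ψ₀) t 0 := fun s hs => by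
      have e : Df (seg (z ψ₀) s) (seg 0 s) = 0 := map_zero _
      exact (hasDerivWithinAt_const s _ (0 : Fin m → ℝ)).congr_deriv e.symm
    have := hbox.nrm_varSol_sub_le hU hMB hD (hz ψ₀ h₀) hz₀ (hw ψ₀ h₀ v) h0 le_rfl
      (fun s hs => by simp) k hs
    have e : ∀ s, seg (0 : C(ℝ, Fin m → ℝ)) s = 0 := fun _ => rfl
    rw [e, e, sub_zero, sub_zero, add_zero, hw0 ψ₀ h₀] at this
    exact this.trans (mul_le_mul_of_nonneg_left (hC v hv) (by positivity))
  have e1 : ∀ᶠ ξ : History m in 𝓝 0, ∀ s ∈ Icc 0 t, ∀ u ∈ B',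
      (Df (seg (z ψ₀) s + ξ) - Df (seg (z ψ₀) s)) u ∈ Metric.ball 0 (r / 2 / G) := by
    refine isCompact_Icc.eventually_forall_of_forall_eventually fun s hs => ?_
    have hDat : ContinuousAt Df (seg (z ψ₀) s) :=
      hDc.continuousAt (hU.mem_nhds (hz ψ₀ h₀ s hs).1)
    have e2 : ContinuousAt (fun p : History m × ℝ => Df (seg (z ψ₀) p.2 + p.1)) (0, s) :=
      ContinuousAt.comp (f := fun p : History m × ℝ => seg (z ψ₀) p.2 + p.1) (g := Df)
        (by simpa using hDat) (Continuous.continuousAt (by fun_prop))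
    have e3 : ContinuousAt (fun p : History m × ℝ => Df (seg (z ψ₀) p.2)) (0, s) :=
      ContinuousAt.comp (f := fun p : History m × ℝ => seg (z ψ₀) p.2) (g := Df) hDat
        (Continuous.continuousAt (by fun_prop))
    have e4 : Tendsto (fun p : History m × ℝ => Df (seg (z ψ₀) p.2 + p.1) - Df (seg (z ψ₀) p.2))
        (𝓝 (0, s)) (𝓝 0) := by
      simpa [Pi.sub_def] using (e2.sub e3).tendsto
    exact e4.eventually_mem ((ContinuousLinearMap.hasBasis_nhds_zero (σ := RingHom.id ℝ)
      (E := History m) (F := Fin m → ℝ)).mem_of_mem (i := (B', Metric.ball 0 (r / 2 / G)))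
      ⟨hB', Metric.ball_mem_nhds _ hη⟩)
  have e2 := hbox.eventually_forall_seg_sub ht0 hU hMB (hz ψ₀ h₀) (hz0 ψ₀ h₀) e1
  filter_upwards [self_mem_nhdsWithin, nhdsWithin_le_nhds e2,
    nhdsWithin_le_nhds (eventually_nrm_sub_lt j ψ₀ hbox.pos_radius)] with ψ hψ h1 h2 v hv
  have hψ : (t, ψ) ∈ flowDom U f := hψ
  have hb := hbox.nrm_varSol_sub_le hU hMB hD (hz ψ hψ) (by rwa [hz0 ψ hψ]) (hw ψ hψ v)
    (hw ψ₀ h₀ v) hη.le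
    (fun s hs => by
      have := h1 (z ψ) (hz ψ hψ) (hz0 ψ hψ) s hs s hs _ ⟨v, hv, s, hs, rfl⟩
      rw [add_sub_cancel, mem_ball_zero_iff] at this
      exact this.le) k ⟨ht0, le_rfl⟩
  rw [hw0 ψ hψ, hw0 ψ₀ h₀, sub_self, nrm_zero, zero_add, mul_div_cancel₀ _ (by positivity)] at hb
  simp only [sub_zero, sub_apply]
  rw [hAw ψ hψ, hAw ψ₀ h₀]
  linarith

theorem isC1_flow (star : Variant) (hU : IsOpen U) (hf : IsC1 star f U) (t : ℝ) :
    IsC1 star (flow U f t) {ψ | (t, ψ) ∈ flowDom U f} := by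
  cases star
  exacts [isC1MB_flow hU hf t, isC1F_flow hU hf t]

theorem IsC1.isC1MB {star : Variant} (hf : IsC1 star f U) : IsC1MB f U := by
  cases star
  exacts [hf, IsC1F.isC1MB hf]

end Smoothness

end DelayEquation

namespace DelayEquation

/-! ### Smoothness under composition with affine maps. -/

section AffineComposition

variable {E E' F F' : Type*}
  [AddCommGroup E] [Module ℝ E] [TopologicalSpace E] [IsTopologicalAddGroup E]
  [AddCommGroup E'] [Module ℝ E'] [TopologicalSpace E']
  [AddCommGroup F] [Module ℝ F] [TopologicalSpace F] [IsTopologicalAddGroup F]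
  [ContinuousSMul ℝ F]
  [AddCommGroup F'] [Module ℝ F'] [TopologicalSpace F'] [IsTopologicalAddGroup F']
  [ContinuousSMul ℝ F']

/-- Smoothness is preserved by composition with continuous affine maps on both sides. -/
theorem IsC1.comp_affine {star : Variant} {f : E → F} {U : Set E} (hf : IsC1 star f U)
    (A : F →L[ℝ] F') (a : F') (B : E' →L[ℝ] E) (b : E) :
    IsC1 star (fun x => a + A (f (b + B x))) ((fun x => b + B x) ⁻¹' U) := by
  have hBc : Continuous fun x => b + B x := by fun_prop
  have hcont : ContinuousOn f U →
      ContinuousOn (fun x => a + A (f (b + B x))) ((fun x => b + B x) ⁻¹' U) := fun h =>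
    continuousOn_const.add (A.continuous.comp_continuousOn
      (h.comp hBc.continuousOn fun x hx => hx))
  have hdir : ∀ {u v w}, HasDirDeriv f (b + B u) (B v) w →
      HasDirDeriv (fun x => a + A (f (b + B x))) u v (A w) := fun {u v w} h => by
    refine ((A.continuous.tendsto w).comp h).congr fun x => ?_
    simp only [Function.comp_apply, map_smul, map_sub, map_add, add_sub_add_left_eq_sub, add_assoc]
  cases star
  · obtain ⟨hfc, Df, hD, hDc⟩ := hf
    refine ⟨hcont hfc, fun u v => A (Df (b + B u) (B v)), fun u hu v => hdir (hD _ hu _), ?_⟩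
    exact A.continuous.comp_continuousOn (hDc.comp
      (f := fun p : E' × E' => (b + B p.1, B p.2)) (Continuous.continuousOn (by fun_prop))
      fun p hp => ⟨hp.1, mem_univ _⟩)
  · obtain ⟨hfc, Df, hD, hDc⟩ := hf
    refine ⟨hcont hfc, fun u => A.comp ((Df (b + B u)).comp B), fun u hu v => hdir (hD _ hu _), ?_⟩
    exact (ContinuousLinearMap.postcomp E' A).continuous.comp_continuousOn
      ((ContinuousLinearMap.precomp F B).continuous.comp_continuousOn
        (hDc.comp hBc.continuousOn fun x hx => hx))

end AffineComposition

/-! ### The augmented right hand side and the clock. -/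

section Augmentation

variable {n : ℕ}

@[fun_prop]
theorem continuous_forget : Continuous (forget : History (n + 1) → History n) :=
  ContinuousMap.continuous_postcomp
    (⟨Fin.tail, by unfold Fin.tail; fun_prop⟩ : C(Fin (n + 1) → ℝ, Fin n → ℝ))

/-- The map `p_n` as a continuous linear map. -/
def forgetL : History (n + 1) →L[ℝ] History n where
  toFun := forget
  map_add' _ _ := rfl
  map_smul' _ _ := rfl
  cont := continuous_forget

/-- The map `ψ ↦ (ψ₁(0), p_n ψ)` as a continuous linear map. -/
def splitL : History (n + 1) →L[ℝ] ℝ × History n where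
  toFun := split
  map_add' _ _ := rfl
  map_smul' _ _ := rfl
  cont := ((continuous_apply 0).comp (continuous_eval_const _)).prodMk
    continuous_forget

theorem continuous_finCons {X : Type*} [TopologicalSpace X] {a : X → ℝ} {b : X → Fin n → ℝ}
    (ha : Continuous a) (hb : Continuous b) :
    Continuous fun x => (Fin.cons (a x) (b x) : Fin (n + 1) → ℝ) :=
  continuous_pi fun i => by
    refine Fin.cases ?_ (fun j => ?_) i
    · simpa using ha
    · simpa using (continuous_pi_iff.1 hb) j

/-- The map `x ↦ (0, x)` as a continuous linear map. -/
def consZeroL : (Fin n → ℝ) →L[ℝ] Fin (n + 1) → ℝ where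
  toFun x := Fin.cons 0 x
  map_add' x y := by
    ext i
    refine Fin.cases ?_ (fun j => ?_) i <;> simp
  map_smul' c x := by
    ext i
    refine Fin.cases ?_ (fun j => ?_) i <;> simp
  cont := continuous_finCons continuous_const continuous_id

theorem continuous_pair {X : Type*} [TopologicalSpace X] {ρ : X → C(Iic (0 : ℝ), ℝ)}
    {φ : X → History n} (hρ : Continuous ρ) (hφ : Continuous φ) :
    Continuous fun x => pair (ρ x) (φ x) := by
  have : LocallyCompactSpace (Iic (0 : ℝ)) :=
    isClosed_Iic.isClosedEmbedding_subtypeVal.locallyCompactSpace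
  refine ContinuousMap.continuous_of_continuous_uncurry _ ?_
  exact continuous_finCons (a := fun p : X × Iic (0 : ℝ) => ρ p.1 p.2)
    (b := fun p : X × Iic (0 : ℝ) => φ p.1 p.2) (by fun_prop) (by fun_prop)

theorem continuous_clock : Continuous clock := by
  refine ContinuousMap.continuous_of_continuous_uncurry _ ?_
  change Continuous fun p : ℝ × Iic (0 : ℝ) => p.1 + (p.2 : ℝ)
  fun_prop

/-- The map `φ ↦ (0, φ)` as a continuous linear map. -/
def pairZeroL : History n →L[ℝ] History (n + 1) where
  toFun φ := pair 0 φ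
  map_add' φ χ := by
    ext s i
    refine Fin.cases ?_ (fun j => ?_) i <;> simp [pair]
  map_smul' c φ := by
    ext s i
    refine Fin.cases ?_ (fun j => ?_) i <;> simp [pair]
  cont := continuous_pair continuous_const continuous_id

theorem pair_eq_add (ρ : C(Iic (0 : ℝ), ℝ)) (φ : History n) :
    pair ρ φ = pair ρ 0 + pairZeroL φ := by
  ext s i
  refine Fin.cases ?_ (fun j => ?_) i <;> simp [pair, pairZeroL]

theorem split_pair_clock (t₀ : ℝ) (φ : History n) : split (pair (clock t₀) φ) = (t₀, φ) := by
  refine Prod.ext ?_ rfl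
  simp [split, pair, clock]

variable {V : Set (ℝ × History n)} {g : ℝ × History n → Fin n → ℝ}

theorem pair_clock_mem_augDom {t₀ : ℝ} {φ : History n} :
    pair (clock t₀) φ ∈ augDom V ↔ (t₀, φ) ∈ V := by
  rw [augDom, mem_ofPred_eq, split_pair_clock]

theorem isOpen_augDom (hV : IsOpen V) : IsOpen (augDom V) :=
  hV.preimage (splitL (n := n)).continuous

/-- $f_g$ is $g$ preceded by the continuous linear map `splitL` and followed by the affine map
$x\mapsto(1,0)+(0,x)$. -/
theorem isC1_augRhs {star : Variant} (hg : IsC1 star g V) : IsC1 star (augRhs g) (augDom V) := by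
  have := hg.comp_affine (consZeroL (n := n)) (Fin.cons 1 0) (splitL (n := n)) 0
  simp only [zero_add] at this
  have e : augRhs g = fun ψ => Fin.cons 1 0 + consZeroL (g (splitL ψ)) := by
    ext ψ i
    refine Fin.cases ?_ (fun j => ?_) i
    · simp [augRhs, consZeroL]
    · simp only [augRhs, consZeroL, ContinuousLinearMap.coe_mk', LinearMap.coe_mk,
        AddHom.coe_mk, Pi.add_apply, Fin.cons_succ, Pi.zero_apply, zero_add]
      rfl
  rw [e]
  exact this

end Augmentation

/-! ### Transfer from the autonomous semiflow to the process. -/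

section NonautonomousEquation

variable {n : ℕ} {V : Set (ℝ × History n)} {g : ℝ × History n → Fin n → ℝ}

theorem coe_lt_sub_coe_iff {r a : ℝ} {te : EReal} :
    (r : EReal) < te - (a : EReal) ↔ ((a + r : ℝ) : EReal) < te := by
  induction te using EReal.rec with
  | bot => simp
  | top => simpa using EReal.coe_lt_top (a + r)
  | coe x =>
    norm_cast
    exact lt_sub_iff_add_lt'

theorem coe_lt_add_coe_iff {r a : ℝ} {te : EReal} :
    (r : EReal) < te + (a : EReal) ↔ ((r - a : ℝ) : EReal) < te := by
  induction te using EReal.rec with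
  | bot => simp
  | top => simpa using EReal.coe_lt_top (r - a)
  | coe x =>
    norm_cast
    exact sub_lt_iff_lt_add.symm

/-- A solution of the nonautonomous equation yields a solution of the autonomous equation. -/
theorem IsIVPSolution.augment {t₀ : ℝ} {φ : History n} {te : EReal} {x : ℝ → Fin n → ℝ}
    (h : IsIVPSolution V g t₀ φ te x) :
    IsIVPSolution (autDom (augDom V)) (autRhs (augRhs g)) 0 (pair (clock t₀) φ) (te - t₀)
      (fun s => Fin.cons (t₀ + s) (x (t₀ + s))) := by
  have hseg : ∀ {s : ℝ} {χ : History n}, IsSegment x (t₀ + s) χ →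
      IsSegment (fun s => Fin.cons (t₀ + s) (x (t₀ + s)) : ℝ → Fin (n + 1) → ℝ) s
        (pair (clock (t₀ + s)) χ) := fun {s χ} hχ u => by
    simp only [pair, clock, ContinuousMap.coe_mk, hχ u, add_assoc]
  refine ⟨coe_lt_sub_coe_iff.2 (by simpa using h.1), fun s hs => ?_, ?_⟩
  · have hs' := coe_lt_sub_coe_iff.1 hs.2
    obtain ⟨χ, h1, h2, h3⟩ := h.2.1 (t₀ + s) ⟨by linarith [hs.1], hs'⟩
    refine ⟨_, hseg h1, pair_clock_mem_augDom.2 h2, ?_⟩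
    rw [autRhs, augRhs, split_pair_clock]
    have hd := hasDerivWithinAt_comp_const_add h3
      (s' := {s : ℝ | 0 ≤ s ∧ (s : EReal) < te - t₀})
      fun r hr => ⟨by linarith [hr.1], coe_lt_sub_coe_iff.1 hr.2⟩
    rw [hasDerivWithinAt_pi] at hd ⊢
    intro i
    refine Fin.cases ?_ (fun j => ?_) i
    · simpa using (hasDerivWithinAt_id s _).const_add t₀
    · simpa using hd j
  · simpa using hseg (s := 0) (by simpa using h.2.2)

/-- The first component of solutions of the autonomous equation is the time. -/
theorem IsIVPSolution.apply_zero_eq {t₀ : ℝ} {φ : History n} {te : EReal}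
    {y : ℝ → Fin (n + 1) → ℝ}
    (h : IsIVPSolution (autDom (augDom V)) (autRhs (augRhs g)) 0 (pair (clock t₀) φ) te y)
    {s : ℝ} (hs : (s : EReal) < te) : y s 0 = t₀ + s := by
  have hneg : ∀ s ≤ 0, y s 0 = t₀ + s := fun s hs => by
    have := congrFun (h.2.2 ⟨s, hs⟩) 0
    simpa [pair, clock] using this.symm
  rcases le_total s 0 with h0 | h0
  · exact hneg s h0
  -- The first component of `augRhs` is 1, so $y_1(r)-r$ has derivative zero.
  have := norm_image_sub_le_of_norm_deriv_le_segment' (f := fun r => y r 0 - r) (f' := fun _ => 0)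
    (a := 0) (b := s) (C := 0) (fun r hr => by
      obtain ⟨χ, -, -, hd⟩ := h.2.1 r ⟨hr.1, lt_of_le_of_lt (by exact_mod_cast hr.2) hs⟩
      have hd0 := hasDerivWithinAt_pi.1 hd 0
      have := (hd0.mono fun q hq => ⟨hq.1, lt_of_le_of_lt (by exact_mod_cast hq.2) hs⟩ :
        HasDerivWithinAt _ _ (Icc 0 s) r).sub (hasDerivWithinAt_id r _)
      simpa [autRhs, augRhs, Pi.sub_def] using this) (fun r hr => by simp) s ⟨h0, le_rfl⟩
  have h1 := hneg 0 le_rfl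
  simp only [zero_mul, norm_le_zero_iff, h1] at this
  linarith

/-- A solution of the autonomous equation yields a solution of the nonautonomous equation. -/
theorem IsIVPSolution.reduce {t₀ : ℝ} {φ : History n} {te : EReal} {y : ℝ → Fin (n + 1) → ℝ}
    (h : IsIVPSolution (autDom (augDom V)) (autRhs (augRhs g)) 0 (pair (clock t₀) φ) te y) :
    IsIVPSolution V g t₀ φ (te + t₀) (fun t => Fin.tail (y (t - t₀))) := by
  refine ⟨coe_lt_add_coe_iff.2 (by simpa using h.1), fun t ht => ?_, fun s => ?_⟩
  · have ht' := coe_lt_add_coe_iff.1 ht.2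
    obtain ⟨χ, h1, h2, h3⟩ := h.2.1 (t - t₀) ⟨sub_nonneg.2 ht.1, ht'⟩
    have hsplit : split χ = (t, forget χ) := by
      refine Prod.ext ?_ rfl
      have := congrFun (h1 ⟨0, self_mem_Iic⟩) 0
      simp only [add_zero, h.apply_zero_eq ht'] at this
      simpa [split] using this
    refine ⟨forget χ, fun s => ?_, ?_, ?_⟩
    · simp only [forget, ContinuousMap.coe_mk, h1 s]
      congr 2
      ring
    · rw [← hsplit]
      exact h2
    · have hd : HasDerivWithinAt (fun r => y (-t₀ + r)) (autRhs (augRhs g) (t - t₀, χ))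
          {r : ℝ | t₀ ≤ r ∧ (r : EReal) < te + t₀} t :=
        hasDerivWithinAt_comp_const_add (s := {s : ℝ | 0 ≤ s ∧ (s : EReal) < te})
          (by rwa [neg_add_eq_sub]) fun r hr =>
            ⟨by linarith [hr.1], by
              simp only [neg_add_eq_sub]
              exact coe_lt_add_coe_iff.1 hr.2⟩
      rw [hasDerivWithinAt_pi] at hd ⊢
      intro i
      have := hd i.succ
      rw [autRhs, augRhs, hsplit] at this
      simpa [Fin.tail, neg_add_eq_sub] using this
  · have := h.2.2 s
    rw [zero_add] at this
    simp only [add_sub_cancel_left, ← this]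
    ext i
    simp [pair, Fin.tail]

theorem mem_processDom_iff {t t₀ : ℝ} {φ : History n} :
    (t, t₀, φ) ∈ processDom V g ↔
      t₀ ≤ t ∧ (t - t₀, pair (clock t₀) φ) ∈ flowDom (augDom V) (augRhs g) := Iff.rfl

theorem mem_of_mem_processDom {t t₀ : ℝ} {φ : History n} (h : (t, t₀, φ) ∈ processDom V g) :
    (t₀, φ) ∈ V :=
  pair_clock_mem_augDom.1 (mem_processDom_iff.1 h).2.2.1

/-- States whose first component is a clock are invariant, with the clock advancing from $t_0$ to
$t$. Hence forgetting that component loses nothing, and the semiflow law becomes the process law. -/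
theorem flow_pair_clock (hV : IsOpen V) (hg : IsC1MB (augRhs g) (augDom V)) {t t₀ : ℝ}
    {φ : History n} (h : (t, t₀, φ) ∈ processDom V g) :
    augFlow V g (t - t₀) (pair (clock t₀) φ) = pair (clock t) (process V g t t₀ φ) := by
  have hU := isOpen_augDom hV
  obtain ⟨-, h⟩ := mem_processDom_iff.1 h
  have hmax := isMaximalSolution_maxSolution hU hg h.2.1
  have hseg := isSegment_maxSolution_flow hU hg h
  ext s i
  refine Fin.cases ?_ (fun j => ?_) i
  · have hs : (s : ℝ) ≤ 0 := s.2
    have : ((t - t₀ + s : ℝ) : EReal) < escapeTime (augDom V) (augRhs g) (pair (clock t₀) φ) :=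
      lt_of_le_of_lt (by exact_mod_cast add_le_of_nonpos_right hs) h.2.2
    rw [augFlow, hseg s, hmax.1.apply_zero_eq this]
    simp only [pair, clock, ContinuousMap.coe_mk, Fin.cons_zero]
    ring
  · simp [pair, process, forget, Fin.tail]

theorem process_add (hV : IsOpen V) (hg : IsC1MB (augRhs g) (augDom V)) {s t t₀ : ℝ}
    {φ : History n} (ht : t₀ ≤ t) (hs : t ≤ s) (h : (t, t₀, φ) ∈ processDom V g)
    (h' : (s, t, process V g t t₀ φ) ∈ processDom V g) :
    (s, t₀, φ) ∈ processDom V g ∧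
      process V g s t₀ φ = process V g s t (process V g t t₀ φ) := by
  have e := flow_pair_clock hV hg h
  have h1 := (mem_processDom_iff.1 h').2
  rw [← e] at h1
  obtain ⟨h2, h3⟩ := flow_add (isOpen_augDom hV) hg (mem_processDom_iff.1 h).2 h1
  rw [sub_add_sub_cancel] at h2 h3
  refine ⟨mem_processDom_iff.2 ⟨ht.trans hs, h2⟩, ?_⟩
  rw [process, process, ← e]
  exact congrArg forget h3.symm

/-- The end time is $t_0$ plus the escape time, and $x$ is the translated tail of the maximal
autonomous solution. Maximality transfers because every competitor augments to an autonomous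
solution. -/
theorem exists_isMaximalSolution (hV : IsOpen V) (hg : IsC1MB (augRhs g) (augDom V)) {t₀ : ℝ}
    {φ : History n} (h : (t₀, φ) ∈ V) :
    ∃ (te : EReal) (x : ℝ → Fin n → ℝ), IsMaximalSolution V g t₀ φ te x ∧
      (∀ t : ℝ, (t, t₀, φ) ∈ processDom V g ↔ t₀ ≤ t ∧ (t : EReal) < te) ∧
      (∀ t : ℝ, (t, t₀, φ) ∈ processDom V g → IsSegment x t (process V g t t₀ φ)) := by
  have hU := isOpen_augDom hV
  have hψ : pair (clock t₀) φ ∈ augDom V := pair_clock_mem_augDom.2 h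
  obtain ⟨hsol, hmax⟩ := isMaximalSolution_maxSolution hU hg hψ
  refine ⟨_, _, ⟨hsol.reduce, fun te' x' hx' => ?_⟩, fun t => ?_, fun t ht s => ?_⟩
  · obtain ⟨hle, heq⟩ := hmax _ _ hx'.augment
    refine ⟨?_, fun s hs => ?_⟩
    · by_contra! hlt
      obtain ⟨r, hr, hr'⟩ := EReal.lt_iff_exists_real_btwn.1 hlt
      have : ((r - t₀ : ℝ) : EReal) < te' - t₀ := coe_lt_sub_coe_iff.2 (by simpa using hr')
      exact hr.not_gt (coe_lt_add_coe_iff.2 (this.trans_le hle))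
    · have := heq (s - t₀) (coe_lt_sub_coe_iff.2 (by simpa using hs))
      simp only [← this, add_sub_cancel, Fin.tail_cons]
  · rw [mem_processDom_iff, coe_lt_add_coe_iff]
    exact ⟨fun h => ⟨h.1, h.2.2.2⟩, fun h => ⟨h.1, sub_nonneg.2 h.1, hψ, h.2⟩⟩
  · have hseg := isSegment_maxSolution_flow hU hg (mem_processDom_iff.1 ht).2 s
    simp only [process, augFlow, forget, ContinuousMap.coe_mk, hseg]
    congr 2
    ring

theorem continuous_processArg : Continuous fun p : ℝ × ℝ × History n =>
    (p.1 - p.2.1, pair (clock p.2.1) p.2.2) :=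
  Continuous.prodMk (by fun_prop)
    (continuous_pair (continuous_clock.comp (by fun_prop)) (by fun_prop))

theorem exists_isOpen_processDom (hV : IsOpen V) (hg : IsC1MB (augRhs g) (augDom V)) :
    ∃ O : Set (ℝ × ℝ × History n), IsOpen O ∧ processDom V g = O ∩ {p | p.2.1 ≤ p.1} := by
  obtain ⟨O, hO, h⟩ := exists_isOpen_flowDom (isOpen_augDom hV) hg
  refine ⟨_, hO.preimage continuous_processArg, ?_⟩
  ext ⟨t, t₀, φ⟩
  rw [mem_processDom_iff, h]
  simp only [mem_inter_iff, mem_preimage, mem_ofPred_eq, sub_nonneg]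
  tauto

theorem continuousOn_process (hV : IsOpen V) (hg : IsC1MB (augRhs g) (augDom V)) :
    ContinuousOn (fun p : ℝ × ℝ × History n => process V g p.1 p.2.1 p.2.2)
      (processDom V g) :=
  continuous_forget.comp_continuousOn ((continuousOn_flow (isOpen_augDom hV) hg).comp
    continuous_processArg.continuousOn fun _ hp => hp.2)

theorem isOpen_processDom_section (hV : IsOpen V) (hg : IsC1MB (augRhs g) (augDom V)) {t t₀ : ℝ}
    (ht : t₀ ≤ t) : IsOpen {φ | (t, t₀, φ) ∈ processDom V g} := by
  obtain ⟨O, hO, h⟩ := exists_isOpen_processDom hV hg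
  have : {φ | (t, t₀, φ) ∈ processDom V g} = (fun φ => (t, t₀, φ)) ⁻¹' O := by
    ext φ
    simp [h, ht]
  rw [this]
  exact hO.preimage (by fun_prop)

/-- For fixed times, $\varphi\mapsto(t_{0*},\varphi)$ is affine and $p_n$ is linear, so smoothness
is inherited from the semiflow. -/
theorem isC1_process {star : Variant} (hV : IsOpen V) (hg : IsC1 star (augRhs g) (augDom V))
    {t t₀ : ℝ} (ht : t₀ ≤ t) :
    IsC1 star (process V g t t₀) {φ | (t, t₀, φ) ∈ processDom V g} := by
  have := (isC1_flow star (isOpen_augDom hV) hg (t - t₀)).comp_affine (forgetL (n := n)) 0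
    pairZeroL (pair (clock t₀) 0)
  convert this using 1
  · ext1 φ
    change forget (flow _ _ _ (pair (clock t₀) φ)) =
      0 + forget (flow _ _ _ (pair (clock t₀) 0 + pairZeroL φ))
    rw [← pair_eq_add, zero_add]
  · ext φ
    change _ ↔ (t - t₀, pair (clock t₀) 0 + pairZeroL φ) ∈ flowDom (augDom V) (augRhs g)
    rw [← pair_eq_add, mem_ofPred_eq, mem_processDom_iff, and_iff_right ht]

end NonautonomousEquation

end DelayEquation

theorem mainTheorem6 (star : Variant) (n : ℕ) (V : Set (ℝ × History n))
    (g : ℝ × History n → Fin n → ℝ) (hV : IsOpen V) (hg : IsC1 star g V) :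
    -- the autonomous equation and its semiflow
    (IsOpen (augDom V) ∧ IsC1 star (augRhs g) (augDom V)) ∧
    (∀ ψ ∈ augDom V,
      IsMaximalSolution (autDom (augDom V)) (autRhs (augRhs g)) 0 ψ
        (escapeTime (augDom V) (augRhs g) ψ) (maxSolution (augDom V) (augRhs g) ψ) ∧
      ∀ t : ℝ, (t, ψ) ∈ augFlowDom V g →
        IsSegment (maxSolution (augDom V) (augRhs g) ψ) t (augFlow V g t ψ)) ∧
    (∀ t ψ, (t, ψ) ∈ augFlowDom V g → augFlow V g t ψ ∈ augDom V) ∧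
    (∀ ψ ∈ augDom V, (0, ψ) ∈ augFlowDom V g ∧ augFlow V g 0 ψ = ψ) ∧
    (∀ s t ψ, (t, ψ) ∈ augFlowDom V g → (s, augFlow V g t ψ) ∈ augFlowDom V g →
      (s + t, ψ) ∈ augFlowDom V g ∧
        augFlow V g s (augFlow V g t ψ) = augFlow V g (s + t) ψ) ∧
    (∃ O : Set (ℝ × History (n + 1)), IsOpen O ∧ augFlowDom V g = O ∩ {p | 0 ≤ p.1}) ∧
    ContinuousOn (fun p : ℝ × History (n + 1) => augFlow V g p.1 p.2) (augFlowDom V g) ∧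
    (∀ t : ℝ, 0 ≤ t → IsOpen {ψ | (t, ψ) ∈ augFlowDom V g} ∧
      IsC1 star (augFlow V g t) {ψ | (t, ψ) ∈ augFlowDom V g}) ∧
    -- the process is continuous on its (relatively open) domain
    (∃ O : Set (ℝ × ℝ × History n), IsOpen O ∧ processDom V g = O ∩ {p | p.2.1 ≤ p.1}) ∧
    ContinuousOn (fun p : ℝ × ℝ × History n => process V g p.1 p.2.1 p.2.2) (processDom V g) ∧
    -- the solution operators are smooth on open sets
    (∀ t t₀ : ℝ, t₀ ≤ t → IsOpen {φ | (t, t₀, φ) ∈ processDom V g} ∧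
      IsC1 star (process V g t t₀) {φ | (t, t₀, φ) ∈ processDom V g}) ∧
    -- maximal solutions, uniqueness
    (∀ t t₀ φ, (t, t₀, φ) ∈ processDom V g → (t₀, φ) ∈ V) ∧
    (∀ t₀ φ, (t₀, φ) ∈ V → ∃ (te : EReal) (x : ℝ → Fin n → ℝ),
      IsMaximalSolution V g t₀ φ te x ∧
      (∀ t : ℝ, (t, t₀, φ) ∈ processDom V g ↔ t₀ ≤ t ∧ (t : EReal) < te) ∧
      (∀ t : ℝ, (t, t₀, φ) ∈ processDom V g → IsSegment x t (process V g t t₀ φ))) ∧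
    -- the process identities
    (∀ t₀ φ, (t₀, φ) ∈ V →
      (t₀, t₀, φ) ∈ processDom V g ∧ process V g t₀ t₀ φ = φ) ∧
    (∀ s t t₀ φ, t₀ ≤ t → t ≤ s → (t, t₀, φ) ∈ processDom V g →
      (s, t, process V g t t₀ φ) ∈ processDom V g →
      (s, t₀, φ) ∈ processDom V g ∧
        process V g s t₀ φ = process V g s t (process V g t t₀ φ)) := by
  have hU := isOpen_augDom hV
  have hf := isC1_augRhs hg
  have hMB := hf.isC1MB
  exact ⟨⟨hU, hf⟩,
    fun ψ hψ => ⟨isMaximalSolution_maxSolution hU hMB hψ,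
      fun t h => isSegment_maxSolution_flow hU hMB h⟩,
    fun t ψ h => flow_mem hU hMB h,
    fun ψ hψ => ⟨zero_mem_flowDom hU hMB hψ, flow_zero hU hMB hψ⟩,
    fun s t ψ ht hs => flow_add hU hMB ht hs,
    exists_isOpen_flowDom hU hMB,
    continuousOn_flow hU hMB,
    fun t ht => ⟨isOpen_flowDom_section hU hMB ht, isC1_flow star hU hf t⟩,
    exists_isOpen_processDom hV hMB,
    continuousOn_process hV hMB,
    fun t t₀ ht => ⟨isOpen_processDom_section hV hMB ht, isC1_process hV hf ht⟩,
    fun t t₀ φ h => mem_of_mem_processDom h,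
    fun t₀ φ h => exists_isMaximalSolution hV hMB h,
    fun t₀ φ h => by
      have hψ := pair_clock_mem_augDom.2 h
      refine ⟨mem_processDom_iff.2 ⟨le_rfl, ?_⟩, ?_⟩
      · rw [sub_self]
        exact zero_mem_flowDom hU hMB hψ
      · rw [process, sub_self, augFlow, flow_zero hU hMB hψ]
        rfl,
    fun s t t₀ φ ht hs h h' => process_add hV hMB ht hs h h'⟩
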